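/- Let $K$ be a field and let $f\in K(z)$ be a rational function of degree $d\ge 2$. Let $t$ be transcendental over $K$, fix a separable closure $K(t)^{\mathrm{sep}}$ of $K(t)$, and let $K^{\mathrm{sep}}\subseteq K(t)^{\mathrm{sep}}$ be the field of elements separable algebraic over $K$. Let $T=\bigsqcup_{n\ge 0}f^{-n}(t)$ be the tree of preimages of $t$ in $\mathbb{P}^1(K(t)^{\mathrm{sep}})$, rooted at $t$, where the parent of a vertex $y\in f^{-(n+1)}(t)$ is $f(y)\in f^{-n}(t)$. Let $\mathrm{Aut}\,T$ be its group of rooted-tree automorphisms, and let $G_\infty(K,f,t)$ and $G_\infty(K^{\mathrm{sep}},f,t)$ be the images in $\mathrm{Aut}\,T$ of the Galois groups $\mathrm{Gal}(K(t)^{\mathrm{sep}}/K(t))$ and $\mathrm{Gal}(K(t)^{\mathrm{sep}}/K^{\mathrm{sep}}(t))$ respectively. Similarly, for $\alpha\in K$ let $T_\alpha=\bigsqcup_{n\ge 0}f^{-n}(\alpha)$ be the tree of preimages of $\alpha$ in $\mathbb{P}^1$ over a separable closure of $K$, and let $G_\infty(K,f,\alpha)\le\mathrm{Aut}\,T_\alpha$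 be the image of the absolute Galois group of $K$. Suppose that $\alpha\in K$ is not strictly post-critical, i.e. $\alpha\notin\bigcup_{n\ge 1}f^n(C_f)$, where $C_f\subseteq\mathbb{P}^1(\overline{K})$ is the set of critical points of $f$ (so that $T_\alpha$ and $T$ are both isomorphic to the $d$-adic rooted tree). If $$|\mathrm{Aut}\,T_\alpha:G_\infty(K,f,\alpha)|<\infty,$$ then $$G_\infty(K^{\mathrm{sep}},f,t)=G_\infty(K,f,t)=\mathrm{Aut}\,T.$$ -/

import Mathlib

namespace Arboreal

open Polynomial

universe u v w

section RationalMap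

variable {K : Type u} [Field K]

/-- The degree of a rational function: the maximum of the degrees of its numerator and denominator
in lowest terms. -/
noncomputable def ratDegree (f : RatFunc K) : ℕ :=
  max f.num.natDegree f.denom.natDegree

open Classical in
/-- The map `ℙ¹(L) → ℙ¹(L)` induced by a rational function `f ∈ K(z)`, for a field extension `L`
of `K`, where `ℙ¹(L) = L ∪ {∞}`. Recall that `f.num` and `f.denom` are coprime. -/
noncomputable def ratMap (f : RatFunc K) (L : Type v) [Field L] [Algebra K L] :
    OnePoint L → OnePoint L
  | OnePoint.infty =>
      if f.denom.natDegree < f.num.natDegree then OnePoint.infty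
      else OnePoint.some
        (algebraMap K L (f.num.coeff f.denom.natDegree / f.denom.leadingCoeff))
  | OnePoint.some x =>
      if aeval x f.denom = 0 then OnePoint.infty
      else OnePoint.some (aeval x f.num / aeval x f.denom)

/-- Critical (i.e. ramification) points of `f = p / q` in `ℙ¹(L)`: a finite point is critical if
`p q' - p' q` vanishes there (at points that are not poles this says `f' = 0`, at poles that
`(1 / f)' = 0`); the point `∞` is critical for `f` if `0` is critical for
`f (1 / z) = (z ^ d * p (1 / z)) / (z ^ d * q (1 / z))`, where `d` is the degree of `f`. -/
def IsCriticalPoint (f : RatFunc K) (L : Type v) [Field L] [Algebra K L] : OnePoint L → Prop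
  | OnePoint.infty =>
      aeval (0 : L)
        (wronskian (f.num.reflect (ratDegree f)) (f.denom.reflect (ratDegree f))) = 0
  | OnePoint.some x => aeval x (wronskian f.num f.denom) = 0

/-- `α ∈ K` is strictly post-critical for `f` if it lies in `⋃ n ≥ 1, f ^ n (C_f)`, where `C_f` is
the set of critical points of `f` (over an algebraic closure of `K`). -/
def IsStrictlyPostcritical (f : RatFunc K) (α : K) : Prop :=
  ∃ n : ℕ, 1 ≤ n ∧ ∃ c : OnePoint (AlgebraicClosure K),
    IsCriticalPoint f (AlgebraicClosure K) c ∧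
      (ratMap f (AlgebraicClosure K))^[n] c =
        OnePoint.some (algebraMap K (AlgebraicClosure K) α)

theorem ratMap_map (f : RatFunc K) {L : Type v} [Field L] [Algebra K L] (σ : L ≃ₐ[K] L)
    (y : OnePoint L) :
    ratMap f L (OnePoint.map σ y) = OnePoint.map σ (ratMap f L y) := by
  cases y with
  | infty =>
    simp only [OnePoint.map_infty, ratMap]
    split_ifs
    · rfl
    · rw [OnePoint.map_some, AlgEquiv.commutes]
  | coe x =>
    have h : ∀ p : K[X], aeval (σ x) p = σ (aeval x p) := fun p => aeval_algHom_apply σ x p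
    by_cases hx : aeval x f.denom = 0
    · simp [ratMap, h, hx]
    · simp [ratMap, h, hx]

theorem ratMap_iterate_map (f : RatFunc K) {L : Type v} [Field L] [Algebra K L] (σ : L ≃ₐ[K] L)
    (n : ℕ) (y : OnePoint L) :
    (ratMap f L)^[n] (OnePoint.map σ y) = OnePoint.map σ ((ratMap f L)^[n] y) :=
  Function.Commute.iterate_left (f := ratMap f L) (g := OnePoint.map σ)
    (fun z => ratMap_map f σ z) n y

end RationalMap

section Tree

variable {K : Type u} [Field K] {L : Type v} [Field L] [Algebra K L]

/-- The vertices of the tree of preimages of a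
point `x ∈ L`, the disjoint union
over `n ≥ 0` of the sets `f ^ (-n) (x)` in `ℙ¹(L)`; the first component of a vertex is its level. -/
def PreimageTree (f : RatFunc K) (x : L) : Type v :=
  Σ n : ℕ, {y : OnePoint L // (ratMap f L)^[n] y = OnePoint.some x}

/-- The parent of a vertex `y` at level `n + 1` is the vertex `f y` at level `n`. The root is sent
to itself. -/
noncomputable def PreimageTree.parent {f : RatFunc K} {x : L} :
    PreimageTree f x → PreimageTree f x
  | ⟨0, y⟩ => ⟨0, y⟩
  | ⟨n + 1, y⟩ => ⟨n, ratMap f L y.1, y.2⟩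

/-- The automorphism group of the rooted tree of preimages of `x`: the permutations of the vertices
that preserve the levels and the parent-child relation. -/
def treeAut (f : RatFunc K) (x : L) : Subgroup (Equiv.Perm (PreimageTree f x)) where
  carrier := {g | ∀ v, (g v).1 = v.1 ∧ (g v).parent = g v.parent}
  one_mem' := fun _ => ⟨rfl, rfl⟩
  mul_mem' := by
    intro a b ha hb v
    refine ⟨(ha (b v)).1.trans (hb v).1, ?_⟩
    rw [Equiv.Perm.mul_apply, Equiv.Perm.mul_apply, (ha (b v)).2, (hb v).2]
  inv_mem' := by
    intro a ha v
    have e : a (a⁻¹ v) = v := Equiv.apply_symm_apply a v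
    have h := ha (a⁻¹ v)
    rw [e] at h
    exact ⟨h.1.symm, by rw [h.2]; exact (Equiv.symm_apply_apply a _).symm⟩

end Tree

section Representation

variable {K : Type u} [Field K] (f : RatFunc K) (F : Type w) [Field F] [Algebra K F]
  {L : Type v} [Field L] [Algebra K L] [Algebra F L] [IsScalarTower K F L]

theorem iterate_map_eq {x : L} (hx : x ∈ Set.range (algebraMap F L)) (σ : Gal(L/F)) {n : ℕ}
    {y : OnePoint L} (hy : (ratMap f L)^[n] y = OnePoint.some x) :
    (ratMap f L)^[n] (OnePoint.map σ y) = OnePoint.some x := by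
  have h := ratMap_iterate_map f (σ.restrictScalars K) n y
  obtain ⟨a, rfl⟩ := hx
  refine h.trans ?_
  rw [hy, OnePoint.map_some]
  exact congrArg OnePoint.some (σ.commutes a)

/-- The action of `σ ∈ Gal(L/F)` on the vertices of the tree of preimages of `x ∈ F`. -/
def galMap {x : L} (hx : x ∈ Set.range (algebraMap F L)) (σ : Gal(L/F)) (v : PreimageTree f x) :
    PreimageTree f x :=
  ⟨v.1, OnePoint.map σ v.2.1, iterate_map_eq f F hx σ v.2.2⟩

theorem galMap_one {x : L} (hx : x ∈ Set.range (algebraMap F L)) (v : PreimageTree f x) :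
    galMap f F hx 1 v = v := by
  obtain ⟨n, y, hy⟩ := v
  exact congrArg (Sigma.mk n) (Subtype.ext (congrFun OnePoint.map_id y))

theorem galMap_mul {x : L} (hx : x ∈ Set.range (algebraMap F L)) (σ τ : Gal(L/F))
    (v : PreimageTree f x) : galMap f F hx (σ * τ) v = galMap f F hx σ (galMap f F hx τ v) := by
  obtain ⟨n, y, hy⟩ := v
  exact congrArg (Sigma.mk n) (Subtype.ext (congrFun (OnePoint.map_comp σ τ) y))

theorem galMap_parent {x : L} (hx : x ∈ Set.range (algebraMap F L)) (σ : Gal(L/F))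
    (v : PreimageTree f x) : (galMap f F hx σ v).parent = galMap f F hx σ v.parent := by
  obtain ⟨n, y, hy⟩ := v
  cases n with
  | zero => rfl
  | succ n =>
    exact congrArg (Sigma.mk n) (Subtype.ext (ratMap_map f (σ.restrictScalars K) y))

/-- The arboreal Galois representation `Gal(L/F) → Aut T`, where `T` is the tree of preimages in
`ℙ¹(L)` of a point `x` of `F` (seen in `L`) under `f ∈ K(z)`, with `K ⊆ F ⊆ L`. -/
def arborealRep {x : L} (hx : x ∈ Set.range (algebraMap F L)) : Gal(L/F) →* treeAut f x where
  toFun σ :=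
    ⟨{ toFun := galMap f F hx σ
       invFun := galMap f F hx σ⁻¹
       left_inv := fun v => by rw [← galMap_mul, inv_mul_cancel, galMap_one]
       right_inv := fun v => by rw [← galMap_mul, mul_inv_cancel, galMap_one] },
      fun v => ⟨rfl, galMap_parent f F hx σ v⟩⟩
  map_one' := Subtype.ext (Equiv.ext (galMap_one f F hx))
  map_mul' σ τ := Subtype.ext (Equiv.ext (galMap_mul f F hx σ τ))

end Representation

section Groups

variable {K : Type u} [Field K] (f : RatFunc K)

/-- The specialization `G_∞(K, f, α)`: the image of `Gal(K^sep/K)` in the automorphism group of the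
tree of preimages of `α ∈ K`, where `Ksep` is a separable closure of `K`. -/
noncomputable def specializationGroup (Ksep : Type v) [Field Ksep] [Algebra K Ksep] (α : K) :
    Subgroup (treeAut f (algebraMap K Ksep α)) :=
  (arborealRep f K (Set.mem_range_self α)).range

variable (Ω : Type v) [Field Ω] [Algebra (RatFunc K) Ω] [Algebra K Ω]
  [IsScalarTower K (RatFunc K) Ω]

/-- The transcendental element `t` of `K(t)`, as an element of an extension `Ω` of `K(t)`. -/
noncomputable def genericPoint : Ω :=
  algebraMap (RatFunc K) Ω RatFunc.X

/-- The arithmetic iterated Galois group `G_∞(K, f, t)`: the image of `Gal(Ω/K(t))` in the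
automorphism group of the tree of preimages of `t`, where `Ω` is a separable closure of `K(t)`. -/
noncomputable def arithmeticGroup : Subgroup (treeAut f (genericPoint (K := K) Ω)) :=
  (arborealRep f (RatFunc K) (Set.mem_range_self RatFunc.X)).range

/-- The field `K^sep(t)` inside a separable closure `Ω` of `K(t)`, where `K^sep` is the field of all
elements of `Ω` that are separable algebraic over `K`. -/
noncomputable def geometricField (K : Type u) [Field K] (Ω : Type v) [Field Ω]
    [Algebra (RatFunc K) Ω] [Algebra K Ω] : IntermediateField (RatFunc K) Ω :=
  IntermediateField.adjoin (RatFunc K) (separableClosure K Ω : Set Ω)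

instance geometricField_isScalarTower (K : Type u) [Field K] (Ω : Type v) [Field Ω]
    [Algebra (RatFunc K) Ω] [Algebra K Ω] [IsScalarTower K (RatFunc K) Ω] :
    IsScalarTower K (geometricField K Ω) Ω :=
  IsScalarTower.of_algebraMap_eq fun _ => rfl

/-- The geometric iterated Galois group `G_∞(K^sep, f, t)`: the image of `Gal(Ω/K^sep(t))` in the
automorphism group of the tree of preimages of `t`. Here `Ω`, a separable closure of `K(t)`, is also
one of `K^sep(t)`. -/
noncomputable def geometricGroup : Subgroup (treeAut f (genericPoint (K := K) Ω)) :=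
  (arborealRep f (geometricField K Ω)
    (Set.mem_range_self (algebraMap (RatFunc K) (geometricField K Ω) RatFunc.X))).range

end Groups

end Arboreal

/-!
Let `t'` be a root of `f t' = t`. The subtree of the tree of preimages of `t` above `t'` is again a
tree of preimages of a transcendental element, so an automorphism `φ` of `K(t)^sep` over `K^sep`
with `φ t = t'` identifies it with the whole tree, and the section at `t'` of the action of `σ` is
the action of `φ⁻¹ σ φ`. Hence the arithmetic group `G` is closed under taking sections at two
different vertices of the first level. If such a group has finite index, it contains all
automorphisms supported above vertices of a deep enough level, and taking sections brings these back
to the root: `G` is the full automorphism group. For the geometric group, realize by `σ` the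
automorphism acting as a given `τ` above `φ t` and trivially elsewhere. Its sections `τ` at `φ t`
and `1` at `ψ t` are realized by `φ⁻¹ σ φ` and `ψ⁻¹ σ ψ`, which agree with `σ` on `K^sep`; their
quotient fixes `K^sep` and acts as `τ`.

Finite index passes from `α` to `t` by putting `t = α + X` in the field of Laurent series over
`K^sep`: since no point of the tree of `α` is critical, Hensel's lemma shows that reduction modulo
`X` is an isomorphism of trees, and `Gal(K^sep/K)` acts compatibly on coefficients.
-/

namespace Arboreal

open Polynomial

universe u v w

section Hensel

variable {R : Type*} [CommRing R]

theorem exists_isFixedPt_of_isAdicComplete {I : Ideal R} [IsAdicComplete I R] {T : R → R} {a : R}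
    (ha : T a - a ∈ I)
    (hT : ∀ n x y, x - a ∈ I → y - a ∈ I → x - y ∈ I ^ n → T x - T y ∈ I ^ (n + 1)) :
    ∃ r, Function.IsFixedPt T r ∧ r - a ∈ I := by
  have hTa : ∀ x, x - a ∈ I → T x - a ∈ I := fun x hx => by
    have h := hT 0 x a hx (by simp) (by simp)
    rw [zero_add, pow_one] at h
    exact sub_add_sub_cancel (T x) (T a) a ▸ I.add_mem h ha
  have hmem : ∀ n, T^[n] a - a ∈ I := fun n => by
    induction n with
    | zero => simp
    | succ n ih => exact Function.iterate_succ_apply' T n a ▸ hTa _ ih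
  have hstep : ∀ n, T^[n + 1] a - T^[n] a ∈ I ^ n := fun n => by
    induction n with
    | zero => simp
    | succ n ih =>
      have h := hT n _ _ (hmem (n + 1)) (hmem n) ih
      rwa [← Function.iterate_succ_apply' T, ← Function.iterate_succ_apply' T] at h
  have hcauchy : ∀ {m n}, m ≤ n → T^[m] a ≡ T^[n] a [SMOD (I ^ m • ⊤ : Ideal R)] := by
    intro m n hmn
    induction n, hmn using Nat.le_induction with
    | base => exact SModEq.rfl
    | succ n hmn ih =>
      refine ih.trans (SModEq.symm (SModEq.sub_mem.2 ?_))
      simpa using Ideal.pow_le_pow_right hmn (hstep n)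
  obtain ⟨r, hr⟩ := IsPrecomplete.prec' _ hcauchy
  have hlim : ∀ n, r - T^[n] a ∈ I ^ n := fun n => by
    simpa using SModEq.sub_mem.1 (hr n).symm
  have hra : r - a ∈ I := by
    have h := hlim 1
    rw [pow_one] at h
    exact sub_add_sub_cancel r _ a ▸ I.add_mem h (hmem 1)
  refine ⟨r, sub_eq_zero.1 (IsHausdorff.haus' (I := I) _ fun n => SModEq.zero.2 ?_), hra⟩
  have h := hT n r _ hra (hmem n) (hlim n)
  rw [← Function.iterate_succ_apply' T] at h
  have h' := (I ^ (n + 1)).sub_mem h (hlim (n + 1))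
  rw [sub_sub_sub_cancel_right] at h'
  simpa using Ideal.pow_le_pow_right n.le_succ h'

-- Mathlib's `HenselianRing` only lifts roots of monic polynomials; here the Newton map
-- `x ↦ x - f(x) / f'(a)` contracts `a + I` whatever the leading coefficient of `f` is.
theorem exists_isRoot_of_isAdicComplete {I : Ideal R} [IsAdicComplete I R] (f : R[X]) {a : R}
    (h₀ : f.eval a ∈ I) (h₁ : IsUnit (f.derivative.eval a)) : ∃ r, f.IsRoot r ∧ r - a ∈ I := by
  obtain ⟨u, hu⟩ := h₁.exists_right_inv
  obtain ⟨r, hr, hra⟩ := exists_isFixedPt_of_isAdicComplete (I := I)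
    (T := fun x => x - u * f.eval x) (a := a) (by simpa using I.mul_mem_left u h₀) (by
      intro n x y hx hy hxy
      obtain ⟨k, hk⟩ := f.binomExpansion y (x - y)
      obtain ⟨l, hl⟩ := f.derivative.evalSubFactor y a
      rw [add_sub_cancel] at hk
      have hfactor : (x - u * f.eval x) - (y - u * f.eval y) =
          (-u * (l * (y - a) + k * ((x - a) - (y - a)))) * (x - y) := by
        linear_combination (-u) * hk - (x - y) * u * hl - (x - y) * hu
      rw [hfactor, pow_succ']
      exact Ideal.mul_mem_mul (I.mul_mem_left _
        (I.add_mem (I.mul_mem_left _ hy) (I.mul_mem_left _ (I.sub_mem hx hy)))) hxy)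
  have hu' : u * f.eval r = 0 := sub_eq_self.1 hr
  refine ⟨r, show f.eval r = 0 from ?_, hra⟩
  linear_combination (f.derivative.eval a) * hu' - f.eval r * hu

theorem isUnit_of_isUnit_map_of_isAdicComplete {S F : Type*} [CommRing S] [FunLike F R S]
    [RingHomClass F R S] (π : F) [IsAdicComplete (RingHom.ker π) R] (hπ : Function.Surjective π)
    {r : R} (h : IsUnit (π r)) : IsUnit r := by
  obtain ⟨s, hs⟩ := h.exists_right_inv
  obtain ⟨s, rfl⟩ := hπ s
  refine isUnit_of_mul_isUnit_left (y := s) (Ideal.isUnit_of_sub_one_mem_jacobson_bot _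
    (IsAdicComplete.le_jacobson_bot (RingHom.ker π) ?_))
  rw [RingHom.mem_ker, map_sub, map_mul, hs, map_one, sub_self]

end Hensel

section HomogeneousCoordinates

variable {L : Type v} [Field L]

open Classical in
/-- The point of `ℙ¹(L) = L ∪ {∞}` with homogeneous coordinates `[x : y]`. The pair `(0, 0)`, which
represents no point, is sent to `∞`. -/
noncomputable def homogPoint (x y : L) : OnePoint L :=
  if y = 0 then OnePoint.infty else OnePoint.some (x / y)

@[simp] theorem homogPoint_zero_right (x : L) : homogPoint x 0 = OnePoint.infty := by
  simp [homogPoint]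

@[simp] theorem homogPoint_one_right (x : L) : homogPoint x 1 = OnePoint.some x := by
  simp [homogPoint]

theorem homogPoint_of_ne_zero (x : L) {y : L} (hy : y ≠ 0) :
    homogPoint x y = OnePoint.some (x / y) := by
  simp [homogPoint, hy]

theorem homogPoint_smul {c : L} (hc : c ≠ 0) (x y : L) :
    homogPoint (c * x) (c * y) = homogPoint x y := by
  by_cases hy : y = 0
  · simp [hy]
  · rw [homogPoint_of_ne_zero _ (mul_ne_zero hc hy), homogPoint_of_ne_zero _ hy,
      mul_div_mul_left _ _ hc]

theorem homogPoint_eq_iff {x y a b : L} (hxy : x ≠ 0 ∨ y ≠ 0) (hab : a ≠ 0 ∨ b ≠ 0) :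
    homogPoint x y = homogPoint a b ↔ b * x = a * y := by
  by_cases hy : y = 0
  · by_cases hb : b = 0
    · simp [hy, hb]
    · have hx : x ≠ 0 := hxy.resolve_right (not_not_intro hy)
      simp [hy, homogPoint_of_ne_zero _ hb, hb, hx, OnePoint.infty_ne_coe]
  · by_cases hb : b = 0
    · have ha : a ≠ 0 := hab.resolve_right (not_not_intro hb)
      simp [hb, homogPoint_of_ne_zero _ hy, hy, ha, OnePoint.coe_ne_infty]
    · rw [homogPoint_of_ne_zero _ hy, homogPoint_of_ne_zero _ hb, OnePoint.coe_eq_coe,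
        div_eq_div_iff hy hb, mul_comm x b]

theorem exists_homogPoint_eq (z : OnePoint L) :
    ∃ x y : L, (x ≠ 0 ∨ y ≠ 0) ∧ homogPoint x y = z := by
  cases z with
  | infty => exact ⟨1, 0, by simp, by simp⟩
  | coe z => exact ⟨z, 1, by simp, by simp⟩

theorem map_homogPoint {L' : Type w} [Field L'] (φ : L →+* L') (x y : L) :
    OnePoint.map φ (homogPoint x y) = homogPoint (φ x) (φ y) := by
  by_cases hy : y = 0
  · simp [hy]
  · rw [homogPoint_of_ne_zero _ hy, homogPoint_of_ne_zero _ ((map_ne_zero φ).2 hy),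
      OnePoint.map_some, map_div₀]

end HomogeneousCoordinates

section RationalMap

variable {K : Type u} [Field K]

theorem aeval_reflect_of_ne_zero {L : Type v} [Field L] [Algebra K L] {p : K[X]} {n : ℕ}
    (hp : p.natDegree ≤ n) {y : L} (hy : y ≠ 0) :
    aeval y (p.reflect n) = y ^ n * aeval y⁻¹ p := by
  let := invertibleOfNonzero (inv_ne_zero hy)
  have h := eval₂_reflect_mul_pow (algebraMap K L) y⁻¹ n p hp
  rw [invOf_eq_inv, inv_inv] at h
  rw [aeval_def, aeval_def, ← h, mul_left_comm, ← mul_pow, mul_inv_cancel₀ hy, one_pow, mul_one]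

theorem aeval_zero_reflect {L : Type v} [Field L] [Algebra K L] (p : K[X]) (n : ℕ) :
    aeval (0 : L) (p.reflect n) = algebraMap K L (p.coeff n) := by
  rw [← coeff_zero_eq_aeval_zero', coeff_reflect, revAt_zero]

variable (f : RatFunc K)

theorem natDegree_num_le_ratDegree : f.num.natDegree ≤ ratDegree f := le_max_left _ _

theorem natDegree_denom_le_ratDegree : f.denom.natDegree ≤ ratDegree f := le_max_right _ _

theorem coeff_ratDegree_ne_zero :
    f.num.coeff (ratDegree f) ≠ 0 ∨ f.denom.coeff (ratDegree f) ≠ 0 := by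
  rcases le_or_gt f.num.natDegree f.denom.natDegree with h | h
  · rw [ratDegree, max_eq_right h]
    exact Or.inr (leadingCoeff_ne_zero.2 f.denom_ne_zero)
  · rw [ratDegree, max_eq_left h.le]
    exact Or.inl (leadingCoeff_ne_zero.2 (ne_zero_of_natDegree_gt h))

variable {L : Type v} [Field L] [Algebra K L]

theorem aeval_num_ne_zero_or (x : L) : aeval x f.num ≠ 0 ∨ aeval x f.denom ≠ 0 :=
  aeval_ne_zero_of_isCoprime f.isCoprime_num_denom x

theorem aeval_reflect_num_ne_zero_or (y : L) :
    aeval y (f.num.reflect (ratDegree f)) ≠ 0 ∨ aeval y (f.denom.reflect (ratDegree f)) ≠ 0 := by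
  by_cases hy : y = 0
  · simpa only [hy, aeval_zero_reflect, _root_.map_ne_zero] using coeff_ratDegree_ne_zero f
  · rw [aeval_reflect_of_ne_zero (natDegree_num_le_ratDegree f) hy,
      aeval_reflect_of_ne_zero (natDegree_denom_le_ratDegree f) hy]
    exact (aeval_num_ne_zero_or f y⁻¹).imp (mul_ne_zero (pow_ne_zero _ hy))
      (mul_ne_zero (pow_ne_zero _ hy))

theorem ratMap_homogPoint_one_right (x : L) :
    ratMap f L (homogPoint x 1) = homogPoint (aeval x f.num) (aeval x f.denom) := by
  rw [homogPoint_one_right]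
  rfl

theorem ratMap_homogPoint_one_left (y : L) :
    ratMap f L (homogPoint 1 y) = homogPoint (aeval y (f.num.reflect (ratDegree f)))
      (aeval y (f.denom.reflect (ratDegree f))) := by
  by_cases hy : y = 0
  · rw [hy, homogPoint_zero_right, aeval_zero_reflect, aeval_zero_reflect]
    by_cases h : f.denom.natDegree < f.num.natDegree
    · have h0 : f.denom.coeff (ratDegree f) = 0 :=
        coeff_eq_zero_of_natDegree_lt (lt_max_of_lt_left h)
      rw [h0, map_zero, homogPoint_zero_right]
      exact if_pos h
    · have h0 : algebraMap K L f.denom.leadingCoeff ≠ 0 :=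
        (_root_.map_ne_zero _).2 (leadingCoeff_ne_zero.2 f.denom_ne_zero)
      rw [ratDegree, max_eq_right (not_lt.1 h), coeff_natDegree, homogPoint_of_ne_zero _ h0,
        ← map_div₀]
      exact if_neg h
  · have hpoint : homogPoint 1 y = homogPoint y⁻¹ 1 := by
      rw [← homogPoint_smul (inv_ne_zero hy), mul_one, inv_mul_cancel₀ hy]
    rw [hpoint, ratMap_homogPoint_one_right,
      aeval_reflect_of_ne_zero (natDegree_num_le_ratDegree f) hy,
      aeval_reflect_of_ne_zero (natDegree_denom_le_ratDegree f) hy,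
      homogPoint_smul (pow_ne_zero _ hy)]

theorem ratMap_homogPoint_one_right_eq_iff (x : L) {a b : L} (hab : a ≠ 0 ∨ b ≠ 0) :
    ratMap f L (homogPoint x 1) = homogPoint a b ↔ b * aeval x f.num = a * aeval x f.denom := by
  rw [ratMap_homogPoint_one_right, homogPoint_eq_iff (aeval_num_ne_zero_or f x) hab]

theorem ratMap_homogPoint_one_left_eq_iff (y : L) {a b : L} (hab : a ≠ 0 ∨ b ≠ 0) :
    ratMap f L (homogPoint 1 y) = homogPoint a b ↔
      b * aeval y (f.num.reflect (ratDegree f)) = a * aeval y (f.denom.reflect (ratDegree f)) := by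
  rw [ratMap_homogPoint_one_left, homogPoint_eq_iff (aeval_reflect_num_ne_zero_or f y) hab]

theorem ratMap_map_algHom {L' : Type w} [Field L'] [Algebra K L'] (φ : L →ₐ[K] L')
    (z : OnePoint L) :
    ratMap f L' (OnePoint.map φ z) = OnePoint.map φ (ratMap f L z) := by
  have hmap : ∀ x y : L, OnePoint.map φ (homogPoint x y) = homogPoint (φ x) (φ y) :=
    map_homogPoint φ.toRingHom
  cases z with
  | infty =>
    rw [← homogPoint_zero_right 1, ratMap_homogPoint_one_left, hmap, hmap, map_one, map_zero,
      ratMap_homogPoint_one_left, ← map_zero φ, aeval_algHom_apply, aeval_algHom_apply]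
  | coe x =>
    rw [← homogPoint_one_right, ratMap_homogPoint_one_right, hmap, hmap, map_one,
      ratMap_homogPoint_one_right, aeval_algHom_apply, aeval_algHom_apply]

theorem IsCriticalPoint.map_algHom {f : RatFunc K} {L' : Type w} [Field L'] [Algebra K L']
    (φ : L →ₐ[K] L') {z : OnePoint L} (hz : IsCriticalPoint f L z) :
    IsCriticalPoint f L' (OnePoint.map φ z) := by
  cases z with
  | infty =>
    have h := congrArg φ (show aeval (0 : L) _ = 0 from hz)
    rwa [← aeval_algHom_apply, map_zero] at h
  | coe x =>
    have h := congrArg φ (show aeval x _ = 0 from hz)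
    rwa [← aeval_algHom_apply, map_zero] at h

end RationalMap

section Pencil

variable {K : Type u} [Field K]

/-- The member `b p - a q` of the pencil spanned by two polynomials `p` and `q`. For `f = p / q` its
roots are the finite points of the fiber of `f` over `[a : b]`. -/
noncomputable def pencil {R : Type v} [CommRing R] [Algebra K R] (p q : K[X]) (a b : R) : R[X] :=
  C b * p.map (algebraMap K R) - C a * q.map (algebraMap K R)

section CommRing

variable {R : Type v} [CommRing R] [Algebra K R] (p q : K[X]) (a b : R)

theorem coeff_pencil (i : ℕ) : (pencil p q a b).coeff i =
    b * algebraMap K R (p.coeff i) - a * algebraMap K R (q.coeff i) := by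
  simp [pencil]

theorem eval_pencil (z : R) : (pencil p q a b).eval z = b * aeval z p - a * aeval z q := by
  simp [pencil, aeval_def, eval_map]

theorem map_pencil {S : Type w} [CommRing S] [Algebra K S] (φ : R →ₐ[K] S) :
    (pencil p q a b).map (φ : R →+* S) = pencil p q (φ a) (φ b) := by
  simp [pencil, Polynomial.map_map]

theorem derivative_pencil :
    derivative (pencil p q a b) = pencil (derivative p) (derivative q) a b := by
  simp only [pencil, derivative_sub, derivative_C_mul, derivative_map]

theorem reflect_pencil (n : ℕ) :
    (pencil p q a b).reflect n = pencil (p.reflect n) (q.reflect n) a b := by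
  simp only [pencil, reflect_sub, reflect_C_mul, reflect_map]

theorem natDegree_pencil_le : (pencil p q a b).natDegree ≤ max p.natDegree q.natDegree :=
  (natDegree_sub_le _ _).trans (max_le_max ((natDegree_C_mul_le _ _).trans natDegree_map_le)
    ((natDegree_C_mul_le _ _).trans natDegree_map_le))

variable {p q a b}

theorem aeval_wronskian_eq_zero [IsDomain R] (hab : a ≠ 0 ∨ b ≠ 0) {z : R}
    (h₀ : (pencil p q a b).eval z = 0) (h₁ : (derivative (pencil p q a b)).eval z = 0) :
    aeval z (wronskian p q) = 0 := by
  rw [eval_pencil] at h₀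
  rw [derivative_pencil, eval_pencil] at h₁
  simp only [wronskian, map_sub, map_mul]
  rcases hab with ha | hb
  · refine (mul_eq_zero_iff_left ha).1 ?_
    linear_combination aeval z (derivative p) * h₀ - aeval z p * h₁
  · refine (mul_eq_zero_iff_left hb).1 ?_
    linear_combination aeval z (derivative q) * h₀ - aeval z q * h₁

end CommRing

section Field

variable {E : Type v} [Field E] [Algebra K E] {p q : K[X]} {a b : E}

theorem natDegree_eq_zero_of_isCoprime_of_C_mul_eq {p q : E[X]} (hpq : IsCoprime p q) {r s : E}
    (hr : r ≠ 0) (h : C r * p = C s * q) : p.natDegree = 0 ∧ q.natDegree = 0 := by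
  have hdvd : q ∣ p :=
    (isUnit_C.2 hr.isUnit).dvd_mul_left.1 (h ▸ dvd_mul_left q (C s))
  have hq : q.natDegree = 0 := natDegree_eq_zero_of_isUnit (hpq.isUnit_of_dvd' hdvd dvd_rfl)
  refine ⟨Nat.le_zero.1 ?_, hq⟩
  rw [← natDegree_C_mul hr, h, ← hq]
  exact natDegree_C_mul_le _ _

theorem pencil_ne_zero (hpq : IsCoprime p q) (hdeg : 1 ≤ max p.natDegree q.natDegree)
    (hab : a ≠ 0 ∨ b ≠ 0) : pencil p q a b ≠ 0 := by
  intro h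
  have hcop : IsCoprime (p.map (algebraMap K E)) (q.map (algebraMap K E)) :=
    hpq.map (mapRingHom (algebraMap K E))
  have heq : C b * p.map (algebraMap K E) = C a * q.map (algebraMap K E) := sub_eq_zero.1 h
  have hconst : p.natDegree = 0 ∧ q.natDegree = 0 := by
    rw [← natDegree_map (algebraMap K E) (p := p), ← natDegree_map (algebraMap K E) (p := q)]
    rcases hab with ha | hb
    · exact (natDegree_eq_zero_of_isCoprime_of_C_mul_eq hcop.symm ha heq.symm).symm
    · exact natDegree_eq_zero_of_isCoprime_of_C_mul_eq hcop hb heq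
  simp [hconst] at hdeg

theorem separable_pencil (M : Type w) [Field M] [IsAlgClosed M] [Algebra K M] [Algebra E M]
    [IsScalarTower K E M] (hab : a ≠ 0 ∨ b ≠ 0)
    (h : ∀ z : M, aeval z (pencil p q a b) = 0 → aeval z (wronskian p q) ≠ 0) :
    (pencil p q a b).Separable := by
  refine (isCoprime_iff_aeval_ne_zero_of_isAlgClosed E M _ _).2 fun z => ?_
  by_contra! hz
  have hmap : (pencil p q a b).map (algebraMap E M) =
      pencil p q (algebraMap E M a) (algebraMap E M b) :=
    map_pencil p q a b (IsScalarTower.toAlgHom K E M)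
  refine h z hz.1 (aeval_wronskian_eq_zero (a := algebraMap E M a) (b := algebraMap E M b)
    (by simpa using hab) ?_ ?_)
  · rw [← hmap, eval_map_algebraMap, hz.1]
  · rw [← hmap, derivative_map, eval_map_algebraMap, hz.2]

theorem exists_lift_root_pencil {R : Type w} [CommRing R] [Algebra K R] (π : R →ₐ[K] E)
    [IsAdicComplete (RingHom.ker π) R] (hπ : Function.Surjective π) {a b : R}
    (hab : π a ≠ 0 ∨ π b ≠ 0) {c : E} (hc : (pencil p q (π a) (π b)).eval c = 0)
    (hW : aeval c (wronskian p q) ≠ 0) : ∃ r, (pencil p q a b).eval r = 0 ∧ π r = c := by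
  obtain ⟨c, rfl⟩ := hπ c
  have heval : ∀ g : R[X], π (g.eval c) = (g.map (π : R →+* E)).eval (π c) := fun g =>
    (eval_map_apply (f := (π : R →+* E)) c).symm
  obtain ⟨r, hr, hrc⟩ := exists_isRoot_of_isAdicComplete (I := RingHom.ker π) (pencil p q a b)
    (a := c) (by rwa [RingHom.mem_ker, heval, map_pencil]) (by
      refine isUnit_of_isUnit_map_of_isAdicComplete π hπ (IsUnit.mk0 _ fun h₁ => hW ?_)
      refine aeval_wronskian_eq_zero hab hc ?_
      rwa [← map_pencil, derivative_map, ← heval])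
  exact ⟨r, hr, sub_eq_zero.1 (map_sub π r c ▸ hrc)⟩

end Field

end Pencil

section Fibers

variable {K : Type u} [Field K] (f : RatFunc K) {E : Type v} [Field E] [Algebra K E] {a b : E}

theorem ratMap_some_eq_iff (hab : a ≠ 0 ∨ b ≠ 0) (z : E) :
    ratMap f E (OnePoint.some z) = homogPoint a b ↔
      (pencil f.num f.denom a b).eval z = 0 := by
  rw [← homogPoint_one_right, ratMap_homogPoint_one_right_eq_iff f z hab, eval_pencil, sub_eq_zero]

theorem ratMap_infty_eq_iff (hab : a ≠ 0 ∨ b ≠ 0) :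
    ratMap f E OnePoint.infty = homogPoint a b ↔
      (pencil f.num f.denom a b).coeff (ratDegree f) = 0 := by
  rw [← homogPoint_zero_right 1, ratMap_homogPoint_one_left_eq_iff f 0 hab, aeval_zero_reflect,
    aeval_zero_reflect, coeff_pencil, sub_eq_zero]

theorem isCriticalPoint_infty_of_coeff_eq_zero (hd : 1 ≤ ratDegree f) (hab : a ≠ 0 ∨ b ≠ 0)
    (h₀ : (pencil f.num f.denom a b).coeff (ratDegree f) = 0)
    (h₁ : (pencil f.num f.denom a b).coeff (ratDegree f - 1) = 0) :
    IsCriticalPoint f E OnePoint.infty := by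
  refine aeval_wronskian_eq_zero hab ?_ ?_
  · rw [← reflect_pencil, ← coeff_zero_eq_eval_zero, coeff_reflect, revAt_zero, h₀]
  · rw [← reflect_pencil, ← coeff_zero_eq_eval_zero, coeff_derivative, coeff_reflect, zero_add,
      revAt_le hd, h₁, zero_mul]

theorem pencil_num_denom_ne_zero (hd : 1 ≤ ratDegree f) (hab : a ≠ 0 ∨ b ≠ 0) :
    pencil f.num f.denom a b ≠ 0 :=
  pencil_ne_zero f.isCoprime_num_denom hd hab

theorem fiber_homogPoint_eq (hd : 1 ≤ ratDegree f) (hab : a ≠ 0 ∨ b ≠ 0) :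
    {z | ratMap f E z = homogPoint a b} =
      OnePoint.some '' (pencil f.num f.denom a b).rootSet E ∪
        {z | z = OnePoint.infty ∧ (pencil f.num f.denom a b).coeff (ratDegree f) = 0} := by
  have h0 := pencil_num_denom_ne_zero f hd hab
  ext z
  cases z with
  | infty => simp [ratMap_infty_eq_iff f hab, OnePoint.coe_ne_infty]
  | coe z => simp [ratMap_some_eq_iff f hab, mem_rootSet, h0, OnePoint.coe_ne_infty]

theorem fiber_finite (hd : 1 ≤ ratDegree f) (u : OnePoint E) : {z | ratMap f E z = u}.Finite := by
  obtain ⟨a, b, hab, rfl⟩ := exists_homogPoint_eq u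
  rw [fiber_homogPoint_eq f hd hab]
  exact ((rootSet_finite _ _).image _).union
    ((Set.finite_singleton OnePoint.infty).subset fun z hz => hz.1)

open Classical in
theorem ncard_fiber_homogPoint (hd : 1 ≤ ratDegree f) (hab : a ≠ 0 ∨ b ≠ 0) :
    {z | ratMap f E z = homogPoint a b}.ncard = ((pencil f.num f.denom a b).rootSet E).ncard +
      if (pencil f.num f.denom a b).coeff (ratDegree f) = 0 then 1 else 0 := by
  have hinfty : {z : OnePoint E | z = OnePoint.infty ∧
      (pencil f.num f.denom a b).coeff (ratDegree f) = 0}.ncard =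
        if (pencil f.num f.denom a b).coeff (ratDegree f) = 0 then 1 else 0 := by
    split_ifs with h <;> simp [h, Set.ofPred_eq_eq_singleton]
  have hdisj : Disjoint (OnePoint.some '' (pencil f.num f.denom a b).rootSet E)
      {z | z = OnePoint.infty ∧ (pencil f.num f.denom a b).coeff (ratDegree f) = 0} := by
    rw [Set.disjoint_left]
    rintro _ ⟨z, -, rfl⟩ ⟨hz, -⟩
    exact OnePoint.coe_ne_infty z hz
  rw [fiber_homogPoint_eq f hd hab, Set.ncard_union_eq hdisj ((rootSet_finite _ _).image _)
    ((Set.finite_singleton OnePoint.infty).subset fun z hz => hz.1), hinfty,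
    Set.ncard_image_of_injective _ OnePoint.coe_injective]

open Classical in
theorem natDegree_add_ite_le {R : Type w} [Semiring R] {p : R[X]} {n : ℕ} (hp : p ≠ 0)
    (hn : p.natDegree ≤ n) : p.natDegree + (if p.coeff n = 0 then 1 else 0) ≤ n := by
  split_ifs with h
  · exact hn.lt_of_ne fun hn' => hp (leadingCoeff_eq_zero.1 (by rwa [← hn'] at h))
  · exact hn

theorem ncard_fiber_le (hd : 1 ≤ ratDegree f) (u : OnePoint E) :
    {z | ratMap f E z = u}.ncard ≤ ratDegree f := by
  obtain ⟨a, b, hab, rfl⟩ := exists_homogPoint_eq u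
  rw [ncard_fiber_homogPoint f hd hab]
  exact (Nat.add_le_add_right (ncard_rootSet_le _ E) _).trans
    (natDegree_add_ite_le (pencil_num_denom_ne_zero f hd hab) (natDegree_pencil_le _ _ _ _))

theorem ncard_fiber_eq [IsSepClosed E] (hd : 1 ≤ ratDegree f) (M : Type w) [Field M]
    [IsAlgClosed M] [Algebra K M] [Algebra E M] [IsScalarTower K E M] {u : OnePoint E}
    (h : ∀ c : OnePoint M, ratMap f M c = OnePoint.map (algebraMap E M) u →
      ¬ IsCriticalPoint f M c) :
    {z | ratMap f E z = u}.ncard = ratDegree f := by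
  obtain ⟨a, b, hab, rfl⟩ := exists_homogPoint_eq u
  have hab' : algebraMap E M a ≠ 0 ∨ algebraMap E M b ≠ 0 := by simpa using hab
  have hsep : (pencil f.num f.denom a b).Separable := separable_pencil M hab fun z hz => by
    refine h (OnePoint.some z) ?_
    have hmap := map_pencil f.num f.denom a b (IsScalarTower.toAlgHom K E M)
    rw [map_homogPoint, ratMap_some_eq_iff f hab', ← hz, ← eval_map_algebraMap]
    exact congrArg (eval z) hmap.symm
  have hcard : ((pencil f.num f.denom a b).rootSet E).ncard =
      (pencil f.num f.denom a b).natDegree := by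
    rw [Set.ncard_eq_toFinset_card', Set.toFinset_card]
    exact card_rootSet_eq_natDegree hsep (IsSepClosed.splits_codomain _ hsep)
  refine (ncard_fiber_le f hd _).antisymm ?_
  rw [ncard_fiber_homogPoint f hd hab, hcard]
  split_ifs with hinfty
  · have hcrit : ¬ IsCriticalPoint f E OnePoint.infty := fun hcrit => by
      refine h OnePoint.infty ?_ (hcrit.map_algHom (IsScalarTower.toAlgHom K E M))
      rw [← (ratMap_infty_eq_iff f hab).2 hinfty]
      exact ratMap_map_algHom f (IsScalarTower.toAlgHom K E M) OnePoint.infty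
    have := le_natDegree_of_ne_zero fun h₁ =>
      hcrit (isCriticalPoint_infty_of_coeff_eq_zero f hd hab hinfty h₁)
    omega
  · exact le_natDegree_of_ne_zero hinfty

end Fibers

section FullTrees

theorem bijOn_iterate_fiber {X : Type v} {Y : Type w} {F : X → X} {F' : Y → Y} {h : X → Y}
    (hc : Function.Semiconj h F F') {x : X}
    (hfib : ∀ n v, F^[n] v = x → Set.BijOn h {z | F z = v} {z | F' z = h v}) (n : ℕ) :
    Set.BijOn h {z | F^[n] z = x} {z | F'^[n] z = h x} := by
  induction n with
  | zero =>
    refine ⟨fun z hz => congrArg h hz, fun y hy z hz _ => hy.trans hz.symm, fun z hz => ?_⟩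
    exact ⟨x, rfl, hz.symm⟩
  | succ n ih =>
    refine ⟨fun z hz => ?_, fun y hy z hz hyz => ?_, fun z hz => ?_⟩
    · exact ((hc.iterate_right (n + 1)).eq z).symm.trans (congrArg h hz)
    · have hparent : F y = F z := ih.injOn hy hz (by rw [hc.eq, hc.eq, hyz])
      exact (hfib n (F z) hz).injOn hparent rfl hyz
    · obtain ⟨v, hv, hvz⟩ := ih.surjOn (show F' z ∈ {z | F'^[n] z = h x} from hz)
      obtain ⟨y, rfl, hyz⟩ := (hfib n v hv).surjOn (show z ∈ {z | F' z = h v} from hvz.symm)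
      exact ⟨y, hv, hyz⟩

variable {K : Type u} [Field K] {f : RatFunc K} {L : Type v} [Field L] [Algebra K L]
  {L' : Type w} [Field L'] [Algebra K L'] {x : L} {x' : L'}

variable (f x) in
/-- The tree of preimages of `x` in `ℙ¹(L)` is full if every vertex has as many children as the
degree of `f`, that is, if it is a `d`-adic rooted tree for `d` the degree of `f`. -/
def IsFullTree : Prop :=
  ∀ n v, (ratMap f L)^[n] v = OnePoint.some x → {z | ratMap f L z = v}.ncard = ratDegree f

variable {h : OnePoint L → OnePoint L'}

theorem mapsTo_fiber (hc : Function.Semiconj h (ratMap f L) (ratMap f L')) (v : OnePoint L) :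
    Set.MapsTo h {z | ratMap f L z = v} {z | ratMap f L' z = h v} := fun z hz =>
  (hc.eq z).symm.trans (congrArg h hz)

theorem IsFullTree.bijOn_of_injective (hx : IsFullTree f x) (hd : 1 ≤ ratDegree f)
    (hc : Function.Semiconj h (ratMap f L) (ratMap f L')) (hinj : Function.Injective h)
    (hroot : h (OnePoint.some x) = OnePoint.some x') (n : ℕ) :
    Set.BijOn h {z | (ratMap f L)^[n] z = OnePoint.some x}
      {z | (ratMap f L')^[n] z = OnePoint.some x'} := by
  refine hroot ▸ bijOn_iterate_fiber hc (fun n v hv => ?_) n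
  have himage : h '' {z | ratMap f L z = v} = {z | ratMap f L' z = h v} :=
    Set.eq_of_subset_of_ncard_le (mapsTo_fiber hc v).image_subset (by
      rw [Set.ncard_image_of_injective _ hinj, hx n v hv]
      exact ncard_fiber_le f hd (h v)) (fiber_finite f hd (h v))
  exact himage ▸ hinj.injOn.bijOn_image

theorem IsFullTree.bijOn_fiber_of_surjOn (hx' : IsFullTree f x') (hd : 1 ≤ ratDegree f)
    (hc : Function.Semiconj h (ratMap f L) (ratMap f L'))
    (hroot : h (OnePoint.some x) = OnePoint.some x') {n : ℕ} {v : OnePoint L}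
    (hv : (ratMap f L)^[n] v = OnePoint.some x)
    (hsurj : Set.SurjOn h {z | ratMap f L z = v} {z | ratMap f L' z = h v}) :
    Set.BijOn h {z | ratMap f L z = v} {z | ratMap f L' z = h v} := by
  have hv' : (ratMap f L')^[n] (h v) = OnePoint.some x' := by
    rw [← (hc.iterate_right n).eq, hv, hroot]
  refine ⟨mapsTo_fiber hc v, fun y hy z hz hyz => ?_, hsurj⟩
  exact Set.inj_on_of_surj_on_of_ncard_le (fun z _ => h z) (mapsTo_fiber hc v)
    (fun z hz => (hsurj hz).imp fun y hy => ⟨hy.1, hy.2⟩)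
    (by rw [hx' n _ hv']; exact ncard_fiber_le f hd v) hy hz hyz (fiber_finite f hd v)

theorem IsFullTree.of_bijOn (hx' : IsFullTree f x')
    (hc : Function.Semiconj h (ratMap f L) (ratMap f L'))
    (hroot : h (OnePoint.some x) = OnePoint.some x')
    (hbij : ∀ n v, (ratMap f L)^[n] v = OnePoint.some x →
      Set.BijOn h {z | ratMap f L z = v} {z | ratMap f L' z = h v}) : IsFullTree f x := by
  intro n v hv
  have hv' : (ratMap f L')^[n] (h v) = OnePoint.some x' := by
    rw [← (hc.iterate_right n).eq, hv, hroot]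
  rw [← hx' n (h v) hv', ← (hbij n v hv).image_eq, (hbij n v hv).injOn.ncard_image]

end FullTrees

section TreeIsomorphisms

variable {K : Type u} [Field K] {f : RatFunc K} {L : Type v} [Field L] [Algebra K L]
  {L' : Type w} [Field L'] [Algebra K L'] {x : L} {x' : L'}

theorem PreimageTree.ext {v v' : PreimageTree f x} (hlevel : v.1 = v'.1)
    (hpoint : v.2.1 = v'.2.1) : v = v' := by
  obtain ⟨n, y, hy⟩ := v
  obtain ⟨n', y', hy'⟩ := v'
  obtain rfl : n = n' := hlevel
  obtain rfl : y = y' := hpoint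
  rfl

variable (h : OnePoint L → OnePoint L')
  (hb : ∀ n, Set.BijOn h {z | (ratMap f L)^[n] z = OnePoint.some x}
    {z | (ratMap f L')^[n] z = OnePoint.some x'})

/-- The bijection of trees of preimages induced by a map `ℙ¹(L) → ℙ¹(L')` that is bijective on
every level. -/
noncomputable def PreimageTree.equiv : PreimageTree f x ≃ PreimageTree f x' :=
  Equiv.sigmaCongrRight fun n => (hb n).equiv

variable (hc : Function.Semiconj h (ratMap f L) (ratMap f L'))

include hc

theorem PreimageTree.equiv_parent (v : PreimageTree f x) :
    (PreimageTree.equiv h hb v).parent = PreimageTree.equiv h hb v.parent := by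
  obtain ⟨n, y, hy⟩ := v
  cases n with
  | zero => rfl
  | succ n => exact congrArg (Sigma.mk n) (Subtype.ext (hc.eq y).symm)

theorem permCongr_mem_treeAut_iff {g : Equiv.Perm (PreimageTree f x)} :
    (PreimageTree.equiv h hb).permCongr g ∈ treeAut f x' ↔ g ∈ treeAut f x := by
  refine (PreimageTree.equiv h hb).surjective.forall.trans (forall_congr' fun v => ?_)
  simp only [Equiv.permCongr_apply, Equiv.symm_apply_apply, PreimageTree.equiv_parent h hb hc,
    EmbeddingLike.apply_eq_iff_eq]
  rfl

theorem map_permCongrHom_treeAut :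
    (treeAut f x).map (PreimageTree.equiv h hb).permCongrHom.toMonoidHom = treeAut f x' := by
  ext g
  obtain ⟨g, rfl⟩ := (PreimageTree.equiv h hb).permCongr.surjective g
  exact (Subgroup.mem_map_iff_mem (PreimageTree.equiv h hb).permCongrHom.injective).trans
    (permCongr_mem_treeAut_iff h hb hc).symm

/-- The isomorphism of automorphism groups of trees of preimages given by conjugation with the
isomorphism of trees induced by a map `ℙ¹(L) → ℙ¹(L')` commuting with `f`. -/
noncomputable def treeAutCongr : treeAut f x ≃* treeAut f x' :=
  ((PreimageTree.equiv h hb).permCongrHom.subgroupMap (treeAut f x)).trans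
    (MulEquiv.subgroupCongr (map_permCongrHom_treeAut h hb hc))

theorem treeAutCongr_arborealRep {F : Type*} [Field F] [Algebra K F] [Algebra F L]
    [IsScalarTower K F L] {F' : Type*} [Field F'] [Algebra K F'] [Algebra F' L']
    [IsScalarTower K F' L'] (hx : x ∈ Set.range (algebraMap F L))
    (hx' : x' ∈ Set.range (algebraMap F' L')) {σ : Gal(L/F)} {τ : Gal(L'/F')}
    (hστ : ∀ y, h (OnePoint.map σ y) = OnePoint.map τ (h y)) :
    treeAutCongr h hb hc (arborealRep f F hx σ) = arborealRep f F' hx' τ := by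
  refine Subtype.ext (Equiv.ext ((PreimageTree.equiv h hb).surjective.forall.2 fun v => ?_))
  refine (congrArg (fun w => PreimageTree.equiv h hb (galMap f F hx σ w))
    ((PreimageTree.equiv h hb).symm_apply_apply v)).trans ?_
  exact PreimageTree.ext rfl (hστ v.2.1)

end TreeIsomorphisms

section NoncriticalPoints

variable {K : Type u} [Field K] {f : RatFunc K}

theorem ratMap_iterate_map_algHom (f : RatFunc K) {L : Type v} [Field L] [Algebra K L]
    {L' : Type w} [Field L'] [Algebra K L'] (φ : L →ₐ[K] L') (n : ℕ) (z : OnePoint L) :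
    (ratMap f L')^[n] (OnePoint.map φ z) = OnePoint.map φ ((ratMap f L)^[n] z) :=
  have hφ : Function.Semiconj (OnePoint.map φ) (ratMap f L) (ratMap f L') := fun z =>
    (ratMap_map_algHom f φ z).symm
  ((hφ.iterate_right n).eq z).symm

theorem mem_range_of_onePoint_map_eq_some {X : Type v} {Y : Type w} {φ : X → Y} {z : OnePoint X}
    {y : Y} (h : OnePoint.map φ z = OnePoint.some y) : y ∈ Set.range φ := by
  cases z with
  | infty => exact absurd h.symm (OnePoint.coe_ne_infty y)
  | coe x => exact ⟨x, OnePoint.coe_injective h⟩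

theorem exists_transcendental_of_iterate_eq {L : Type v} [Field L] [Algebra K L] {t : L}
    (ht : Transcendental K t) {n : ℕ} {c : OnePoint L}
    (h : (ratMap f L)^[n] c = OnePoint.some t) :
    ∃ a : L, c = OnePoint.some a ∧ Transcendental K a := by
  have hc : ∀ c' : OnePoint (algebraicClosure K L),
      OnePoint.map (algebraicClosure K L).val c' ≠ c := by
    rintro c' rfl
    rw [ratMap_iterate_map_algHom] at h
    obtain ⟨s, rfl⟩ := mem_range_of_onePoint_map_eq_some h
    exact ht (mem_algebraicClosure_iff.1 s.2)
  cases c with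
  | infty => exact absurd rfl (hc OnePoint.infty)
  | coe a =>
    exact ⟨a, rfl, fun ha => hc (OnePoint.some ⟨a, mem_algebraicClosure_iff.2 ha⟩) rfl⟩

theorem IsFullTree.of_forall_not_isCriticalPoint (hd : 1 ≤ ratDegree f) {L : Type v} [Field L]
    [IsSepClosed L] [Algebra K L] {x : L}
    (h : ∀ n c, (ratMap f (AlgebraicClosure L))^[n + 1] c =
      OnePoint.some (algebraMap L (AlgebraicClosure L) x) →
        ¬IsCriticalPoint f (AlgebraicClosure L) c) : IsFullTree f x := by
  refine fun n v hv => ncard_fiber_eq f hd (AlgebraicClosure L) fun c hc => h n c ?_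
  rw [Function.iterate_succ_apply, hc]
  refine (ratMap_iterate_map_algHom f (IsScalarTower.toAlgHom K L _) n v).trans ?_
  rw [hv, OnePoint.map_some, IsScalarTower.toAlgHom_apply]

theorem isFullTree_of_transcendental (hd : 1 ≤ ratDegree f) (hW : wronskian f.num f.denom ≠ 0)
    {L : Type v} [Field L] [IsSepClosed L] [Algebra K L] {t : L} (ht : Transcendental K t) :
    IsFullTree f t := by
  refine .of_forall_not_isCriticalPoint hd fun n c hc => ?_
  have ht' : Transcendental K (algebraMap L (AlgebraicClosure L) t) :=
    (transcendental_algebraMap_iff (algebraMap L (AlgebraicClosure L)).injective).2 ht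
  obtain ⟨a, rfl, ha⟩ := exists_transcendental_of_iterate_eq ht' hc
  exact fun hcrit => ha ⟨_, hW, hcrit⟩

variable {α : K}

theorem not_isCriticalPoint_of_not_isStrictlyPostcritical (hα : ¬IsStrictlyPostcritical f α)
    {M : Type v} [Field M] [Algebra K M] [Algebra.IsAlgebraic K M] {n : ℕ} {c : OnePoint M}
    (hc : (ratMap f M)^[n + 1] c = OnePoint.some (algebraMap K M α)) :
    ¬IsCriticalPoint f M c := by
  intro hcrit
  let φ : M →ₐ[K] AlgebraicClosure K := IsAlgClosed.lift
  refine hα ⟨n + 1, Nat.le_add_left 1 n, OnePoint.map φ c, hcrit.map_algHom φ, ?_⟩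
  rw [ratMap_iterate_map_algHom, hc, OnePoint.map_some, φ.commutes]

theorem isFullTree_of_not_isStrictlyPostcritical (hd : 1 ≤ ratDegree f)
    (hα : ¬IsStrictlyPostcritical f α) (E : Type v) [Field E] [IsSepClosed E] [Algebra K E]
    [Algebra.IsAlgebraic K E] : IsFullTree f (algebraMap K E α) := by
  have : Algebra.IsAlgebraic K (AlgebraicClosure E) := Algebra.IsAlgebraic.trans K E _
  refine .of_forall_not_isCriticalPoint hd fun n c hc => ?_
  rw [← IsScalarTower.algebraMap_apply] at hc
  exact not_isCriticalPoint_of_not_isStrictlyPostcritical hα hc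

theorem wronskian_ne_zero_of_not_isStrictlyPostcritical (hd : 2 ≤ ratDegree f)
    (hα : ¬IsStrictlyPostcritical f α) : wronskian f.num f.denom ≠ 0 := by
  intro hW
  have hcard := isFullTree_of_not_isStrictlyPostcritical (one_le_two.trans hd) hα
    (AlgebraicClosure K) 0 _ rfl
  obtain ⟨z, hz, hz_infty⟩ := Set.exists_ne_of_one_lt_ncard (hcard ▸ hd) OnePoint.infty
  obtain ⟨z, rfl⟩ := OnePoint.ne_infty_iff_exists.1 hz_infty
  exact not_isCriticalPoint_of_not_isStrictlyPostcritical (n := 0) hα (c := OnePoint.some z) hz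
    ((congrArg (aeval z) hW).trans (map_zero _))

end NoncriticalPoints

section GenericPoint

theorem exists_ringEquiv_of_isSepClosure {k : Type*} [Field k] {k' : Type*} [Field k']
    (e : k ≃+* k') (Ω : Type*) [Field Ω] [Algebra k Ω] [IsSepClosure k Ω] (Ω' : Type*) [Field Ω']
    [Algebra k' Ω'] [IsSepClosure k' Ω'] :
    ∃ φ : Ω ≃+* Ω', ∀ x, φ (algebraMap k Ω x) = algebraMap k' Ω' (e x) := by
  let : Algebra k Ω' := ((algebraMap k' Ω').comp e.toRingHom).toAlgebra
  have : IsSepClosure k Ω' := by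
    refine ⟨IsSepClosure.sep_closed k', ?_⟩
    have := IsSepClosure.separable (k := k') (K := Ω')
    exact Algebra.IsSeparable.of_equiv_equiv e.symm (RingEquiv.refl Ω') <| RingHom.ext fun x =>
      congrArg (algebraMap k' Ω') (e.apply_symm_apply x)
  exact ⟨(IsSepClosure.equiv k Ω Ω').toRingEquiv, (IsSepClosure.equiv k Ω Ω').commutes⟩

open IntermediateField in
theorem exists_algEquiv_of_transcendental {F : Type*} [Field F] {Ω : Type*} [Field Ω]
    [Algebra F Ω] [IsSepClosed Ω] {t a : Ω} (ht : Transcendental F t) (ha : Transcendental F a)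
    [Algebra.IsSeparable F⟮t⟯ Ω] [Algebra.IsSeparable F⟮a⟯ Ω] :
    ∃ φ : Ω ≃ₐ[F] Ω, φ t = a := by
  let e : F⟮t⟯ ≃ₐ[F] F⟮a⟯ := (RatFunc.algEquivOfTranscendental t ht).symm.trans
    (RatFunc.algEquivOfTranscendental a ha)
  have : IsSepClosure F⟮t⟯ Ω := ⟨inferInstance, inferInstance⟩
  have : IsSepClosure F⟮a⟯ Ω := ⟨inferInstance, inferInstance⟩
  obtain ⟨φ, hφ⟩ := exists_ringEquiv_of_isSepClosure e.toRingEquiv Ω Ω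
  refine ⟨AlgEquiv.ofRingEquiv (f := φ) fun x => ?_, ?_⟩
  · exact (hφ (algebraMap F F⟮t⟯ x)).trans (congrArg (algebraMap F⟮a⟯ Ω) (e.commutes x))
  · have he : (e (AdjoinSimple.gen F t) : Ω) = a := by
      simp only [e, AlgEquiv.trans_apply, RatFunc.algEquivOfTranscendental_symm_gen,
        RatFunc.algEquivOfTranscendental_X]
    exact (hφ (AdjoinSimple.gen F t)).trans he

variable {K : Type u} [Field K] {Ω : Type v} [Field Ω] [Algebra (RatFunc K) Ω]
  [Algebra K Ω] [IsScalarTower K (RatFunc K) Ω]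

theorem transcendental_genericPoint : Transcendental K (genericPoint (K := K) Ω) :=
  (transcendental_algebraMap_iff (algebraMap (RatFunc K) Ω).injective).2 RatFunc.transcendental_X

theorem algebraMap_ratFunc_mem (E : IntermediateField K Ω) (ht : genericPoint (K := K) Ω ∈ E)
    (r : RatFunc K) : algebraMap (RatFunc K) Ω r ∈ E := by
  let E' : IntermediateField K (RatFunc K) := E.comap (IsScalarTower.toAlgHom K (RatFunc K) Ω)
  have htop : E' = ⊤ :=
    top_le_iff.1 (RatFunc.adjoin_X.symm.le.trans (IntermediateField.adjoin_simple_le_iff.2 ht))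
  exact htop.symm.le (IntermediateField.mem_top (x := r))

theorem isSeparable_of_genericPoint_mem [Algebra.IsSeparable (RatFunc K) Ω] {F : Type w} [Field F]
    [Algebra K F] [Algebra F Ω] [IsScalarTower K F Ω] (E : IntermediateField F Ω)
    (ht : genericPoint (K := K) Ω ∈ E) : Algebra.IsSeparable E Ω := by
  let : Algebra (RatFunc K) E := ((algebraMap (RatFunc K) Ω).codRestrict E.toSubfield
    (algebraMap_ratFunc_mem (E.restrictScalars K) ht)).toAlgebra
  have : IsScalarTower (RatFunc K) E Ω := IsScalarTower.of_algebraMap_eq fun _ => rfl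
  exact Algebra.isSeparable_tower_top_of_isSeparable (RatFunc K) E Ω

open IntermediateField in
theorem exists_algEquiv_genericPoint (f : RatFunc K) [IsSepClosure (RatFunc K) Ω] {a : Ω}
    (ha : ratMap f Ω (OnePoint.some a) = OnePoint.some (genericPoint (K := K) Ω)) :
    ∃ φ : Ω ≃ₐ[K] Ω, φ (genericPoint (K := K) Ω) = a ∧ ∀ x ∈ separableClosure K Ω, φ x = x := by
  have : IsSepClosed Ω := IsSepClosure.sep_closed (RatFunc K)
  have : Algebra.IsSeparable (RatFunc K) Ω := IsSepClosure.separable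
  have : Algebra.IsAlgebraic K (separableClosure K Ω) := Algebra.IsSeparable.isAlgebraic _ _
  have ht := transcendental_genericPoint (K := K) (Ω := Ω)
  obtain ⟨_, haa, hat⟩ := exists_transcendental_of_iterate_eq ht (n := 1) (c := OnePoint.some a) ha
  obtain rfl := OnePoint.coe_injective haa
  have hmem : genericPoint (K := K) Ω ∈ (separableClosure K Ω)⟮a⟯ := by
    let ι : (separableClosure K Ω)⟮a⟯ →ₐ[K] Ω := (separableClosure K Ω)⟮a⟯.val.restrictScalars K
    obtain ⟨s, hs⟩ := mem_range_of_onePoint_map_eq_some (φ := ι)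
      ((ratMap_map_algHom f ι (OnePoint.some (AdjoinSimple.gen _ a))).symm.trans ha)
    exact hs ▸ s.2
  have := isSeparable_of_genericPoint_mem (K := K)
    (separableClosure K Ω)⟮genericPoint (K := K) Ω⟯ (mem_adjoin_simple_self _ _)
  have := isSeparable_of_genericPoint_mem (K := K) (separableClosure K Ω)⟮a⟯ hmem
  obtain ⟨φ, hφ⟩ := exists_algEquiv_of_transcendental (F := separableClosure K Ω)
    (fun h => ht (h.restrictScalars K)) (fun h => hat (h.restrictScalars K))
  exact ⟨φ.restrictScalars K, hφ, fun x hx => φ.commutes ⟨x, hx⟩⟩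

theorem exists_gal_of_apply_genericPoint (σ : Ω ≃ₐ[K] Ω)
    (hσ : σ (genericPoint (K := K) Ω) = genericPoint (K := K) Ω) :
    ∃ σ' : Gal(Ω/RatFunc K), ∀ x, σ' x = σ x := by
  let ι : RatFunc K →ₐ[K] Ω := IsScalarTower.toAlgHom K (RatFunc K) Ω
  have hι : σ.toAlgHom.comp ι = ι :=
    IsLocalization.algHom_ext (nonZeroDivisors K[X]) <| Polynomial.algHom_ext <| by
      change σ (ι (algebraMap K[X] (RatFunc K) X)) = ι (algebraMap K[X] (RatFunc K) X)
      rw [RatFunc.algebraMap_X]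
      exact hσ
  exact ⟨AlgEquiv.ofRingEquiv (f := σ.toRingEquiv) fun r => DFunLike.congr_fun hι r, fun _ => rfl⟩

end GenericPoint

section SelfSimilarity

variable {K : Type u} [Field K] {f : RatFunc K} {Ω : Type v} [Field Ω] [Algebra K Ω] {t : Ω}

/-- The embedding of the tree of preimages of `t` onto the subtree above a child of the root that is
the image `φ t` of `t` under an automorphism `φ` of the field. -/
def subtreeEmb (φ : Ω ≃ₐ[K] Ω) (hφ : ratMap f Ω (OnePoint.some (φ t)) = OnePoint.some t) :
    PreimageTree f t ↪ PreimageTree f t where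
  toFun v := ⟨v.1 + 1, OnePoint.map φ v.2.1, by
    rw [Function.iterate_succ_apply', ratMap_iterate_map, v.2.2, OnePoint.map_some, hφ]⟩
  inj' v v' h := by
    have hlevel : v.1 + 1 = v'.1 + 1 := congrArg Sigma.fst h
    have hpoint : OnePoint.map φ v.2.1 = OnePoint.map φ v'.2.1 :=
      congrArg (fun z : PreimageTree f t => z.2.1) h
    exact PreimageTree.ext (Nat.succ_injective hlevel) (Option.map_injective φ.injective hpoint)

variable {φ ψ : Ω ≃ₐ[K] Ω} (hφ : ratMap f Ω (OnePoint.some (φ t)) = OnePoint.some t)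
  (hψ : ratMap f Ω (OnePoint.some (ψ t)) = OnePoint.some t)

theorem PreimageTree.eq_of_level_eq_zero {v v' : PreimageTree f t} (h : v.1 = 0) (h' : v'.1 = 0) :
    v = v' := by
  obtain ⟨_, y, hy⟩ := v
  obtain ⟨_, y', hy'⟩ := v'
  obtain rfl := h
  obtain rfl := h'
  exact PreimageTree.ext rfl (hy.trans hy'.symm)

theorem notMem_range_subtreeEmb_of_level_eq_zero {v : PreimageTree f t} (hv : v.1 = 0) :
    v ∉ Set.range (subtreeEmb φ hφ) := by
  rintro ⟨w, rfl⟩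
  exact Nat.succ_ne_zero _ hv

theorem mem_range_subtreeEmb_iff {n : ℕ} {y : OnePoint Ω}
    {hy : (ratMap f Ω)^[n + 1] y = OnePoint.some t} :
    (⟨n + 1, y, hy⟩ : PreimageTree f t) ∈ Set.range (subtreeEmb φ hφ) ↔
      (ratMap f Ω)^[n] y = OnePoint.some (φ t) := by
  constructor
  · rintro ⟨⟨m, z, hz⟩, hv⟩
    obtain rfl : m = n := Nat.succ_injective (congrArg Sigma.fst hv)
    obtain rfl : OnePoint.map φ z = y := congrArg (fun z : PreimageTree f t => z.2.1) hv
    rw [ratMap_iterate_map, hz, OnePoint.map_some]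
  · intro h
    refine ⟨⟨n, OnePoint.map φ.symm y, ?_⟩, PreimageTree.ext rfl ?_⟩
    · rw [ratMap_iterate_map, h, OnePoint.map_some, AlgEquiv.symm_apply_apply]
    · cases y with
      | infty => rfl
      | coe y => exact congrArg OnePoint.some (φ.apply_symm_apply y)

theorem disjoint_range_subtreeEmb (hne : φ t ≠ ψ t) :
    Disjoint (Set.range (subtreeEmb φ hφ)) (Set.range (subtreeEmb ψ hψ)) := by
  rw [Set.disjoint_left]
  rintro ⟨n, y, hy⟩ h h'
  cases n with
  | zero => exact notMem_range_subtreeEmb_of_level_eq_zero hφ rfl h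
  | succ n =>
    exact hne (OnePoint.coe_injective (((mem_range_subtreeEmb_iff hφ).1 h).symm.trans
      ((mem_range_subtreeEmb_iff hψ).1 h')))

theorem parent_subtreeEmb_of_level_ne_zero {v : PreimageTree f t} (hv : v.1 ≠ 0) :
    (subtreeEmb φ hφ v).parent = subtreeEmb φ hφ v.parent := by
  obtain ⟨n, y, hy⟩ := v
  cases n with
  | zero => exact absurd rfl hv
  | succ n => exact PreimageTree.ext rfl (ratMap_map f φ y)

theorem parent_notMem_range_subtreeEmb {v : PreimageTree f t}
    (hv : v ∉ Set.range (subtreeEmb φ hφ)) : v.parent ∉ Set.range (subtreeEmb φ hφ) := by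
  obtain ⟨n, y, hy⟩ := v
  match n with
  | 0 => exact hv
  | 1 => exact notMem_range_subtreeEmb_of_level_eq_zero hφ rfl
  | n + 2 =>
    intro h
    have hfy : (ratMap f Ω)^[n] (ratMap f Ω y) = OnePoint.some (φ t) :=
      (mem_range_subtreeEmb_iff hφ (y := ratMap f Ω y) (hy := hy)).1 h
    exact hv ((mem_range_subtreeEmb_iff hφ).2 hfy)

theorem parent_subtreeEmb_apply {g : Equiv.Perm (PreimageTree f t)} (hg : g ∈ treeAut f t)
    (v : PreimageTree f t) :
    (subtreeEmb φ hφ (g v)).parent =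
      g.viaEmbedding (subtreeEmb φ hφ) (subtreeEmb φ hφ v).parent := by
  by_cases hv : v.1 = 0
  · have hparent : (subtreeEmb φ hφ v).parent ∉ Set.range (subtreeEmb φ hφ) :=
      notMem_range_subtreeEmb_of_level_eq_zero hφ hv
    rw [PreimageTree.eq_of_level_eq_zero ((hg v).1.trans hv) hv,
      Equiv.Perm.viaEmbedding_apply_of_notMem _ _ _ hparent]
  · rw [parent_subtreeEmb_of_level_ne_zero hφ hv, Equiv.Perm.viaEmbedding_apply, ← (hg v).2,
      parent_subtreeEmb_of_level_ne_zero hφ ((hg v).1.trans_ne hv)]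

theorem viaEmbedding_subtreeEmb_mem_treeAut {g : Equiv.Perm (PreimageTree f t)}
    (hg : g ∈ treeAut f t) : g.viaEmbedding (subtreeEmb φ hφ) ∈ treeAut f t := by
  intro v
  by_cases hv : v ∈ Set.range (subtreeEmb φ hφ)
  · obtain ⟨w, rfl⟩ := hv
    rw [Equiv.Perm.viaEmbedding_apply]
    exact ⟨congrArg (· + 1) (hg w).1, parent_subtreeEmb_apply hφ hg w⟩
  · rw [Equiv.Perm.viaEmbedding_apply_of_notMem _ _ _ hv,
      Equiv.Perm.viaEmbedding_apply_of_notMem _ _ _ (parent_notMem_range_subtreeEmb hφ hv)]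
    exact ⟨rfl, rfl⟩

/-- The automorphism of the tree that acts as `g` on the subtree above the child `φ t` of the root
and trivially elsewhere. -/
noncomputable def extendSubtree (g : treeAut f t) : treeAut f t :=
  ⟨g.1.viaEmbedding (subtreeEmb φ hφ), viaEmbedding_subtreeEmb_mem_treeAut hφ g.2⟩

/-- The automorphism `h` is the section of `g` at the child `φ t` of the root: `g` fixes `φ t` and
acts as `h` on the subtree above it. -/
def IsSection (g h : treeAut f t) : Prop :=
  ∀ v, g.1 (subtreeEmb φ hφ v) = subtreeEmb φ hφ (h.1 v)

variable {hφ} in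
theorem IsSection.inv_mul {g h g' h' : treeAut f t} (H : IsSection hφ g h)
    (H' : IsSection hφ g' h') : IsSection hφ (g⁻¹ * g') (h⁻¹ * h') := by
  intro v
  change g.1.symm (g'.1 (subtreeEmb φ hφ v)) = subtreeEmb φ hφ (h.1.symm (h'.1 v))
  rw [Equiv.symm_apply_eq, H, Equiv.apply_symm_apply, H']

theorem isSection_extendSubtree (g : treeAut f t) : IsSection hφ (extendSubtree hφ g) g :=
  fun v => Equiv.Perm.viaEmbedding_apply _ _ v

theorem isSection_extendSubtree_of_ne (hne : φ t ≠ ψ t) (g : treeAut f t) :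
    IsSection hψ (extendSubtree hφ g) 1 :=
  fun v => Equiv.Perm.viaEmbedding_apply_of_notMem _ _ _
    (Set.disjoint_right.1 (disjoint_range_subtreeEmb hφ hψ hne) ⟨v, rfl⟩)

variable {G : Subgroup (treeAut f t)} (hne : φ t ≠ ψ t)
  (hGφ : ∀ g ∈ G, ∀ h, IsSection hφ g h → h ∈ G) (hGψ : ∀ g ∈ G, ∀ h, IsSection hψ g h → h ∈ G)

include hne hGφ hGψ

theorem mem_of_inv_mul_iterate_extendSubtree_mem {g : treeAut f t} (i k : ℕ)
    (h : ((extendSubtree hψ)^[i] (extendSubtree hφ g))⁻¹ *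
      (extendSubtree hψ)^[i + (k + 1)] (extendSubtree hφ g) ∈ G) : g ∈ G := by
  induction i with
  | zero =>
    rw [zero_add, Function.iterate_succ_apply'] at h
    have hsection := hGφ _ h _ ((isSection_extendSubtree hφ g).inv_mul
      (isSection_extendSubtree_of_ne hψ hφ hne.symm _))
    rwa [mul_one, inv_mem_iff] at hsection
  | succ i ih =>
    rw [Nat.add_right_comm, Function.iterate_succ_apply', Function.iterate_succ_apply'] at h
    exact ih (hGψ _ h _ ((isSection_extendSubtree hψ _).inv_mul (isSection_extendSubtree hψ _)))

/- Two of the automorphisms obtained from `extendSubtree hφ g` by iterating `extendSubtree hψ` lie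
in the same coset of `G`; taking sections of their quotient leads back to `g`. -/
theorem eq_top_of_finiteIndex_of_isSection [G.FiniteIndex] : G = ⊤ := by
  refine eq_top_iff.2 fun g _ => ?_
  let s : ℕ → treeAut f t := fun n => (extendSubtree hψ)^[n] (extendSubtree hφ g)
  have : Finite (treeAut f t ⧸ G) := Subgroup.finite_quotient_of_finiteIndex
  obtain ⟨i, j, hij, hcoset⟩ : ∃ i j, i < j ∧ (s i : treeAut f t ⧸ G) = s j := by
    obtain ⟨i, j, hij, hcoset⟩ := Finite.exists_ne_map_eq_of_infinite
      fun n => (s n : treeAut f t ⧸ G)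
    rcases hij.lt_or_gt with hlt | hlt
    exacts [⟨i, j, hlt, hcoset⟩, ⟨j, i, hlt, hcoset.symm⟩]
  obtain ⟨k, rfl⟩ := Nat.exists_eq_add_of_lt hij
  exact mem_of_inv_mul_iterate_extendSubtree_mem hφ hψ hne hGφ hGψ i k (QuotientGroup.eq.1 hcoset)

end SelfSimilarity

section GaloisGroups

variable {K : Type u} [Field K] {f : RatFunc K} {Ω : Type v} [Field Ω] [Algebra (RatFunc K) Ω]
  [Algebra K Ω] [IsScalarTower K (RatFunc K) Ω]

variable (f Ω) in
/-- The arboreal representation of `Gal(Ω/K(t))` on the tree of preimages of `t`, whose range is the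
arithmetic iterated Galois group. -/
noncomputable def genericRep : Gal(Ω/RatFunc K) →* treeAut f (genericPoint (K := K) Ω) :=
  arborealRep f (RatFunc K) (Set.mem_range_self RatFunc.X)

variable {φ ψ : Ω ≃ₐ[K] Ω} {hφ : ratMap f Ω (OnePoint.some (φ (genericPoint (K := K) Ω))) =
    OnePoint.some (genericPoint (K := K) Ω)}
  {hψ : ratMap f Ω (OnePoint.some (ψ (genericPoint (K := K) Ω))) =
    OnePoint.some (genericPoint (K := K) Ω)}

theorem apply_eq_of_isSection {σ : Gal(Ω/RatFunc K)} {h : treeAut f (genericPoint (K := K) Ω)}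
    (H : IsSection hφ (genericRep f Ω σ) h) :
    σ (φ (genericPoint (K := K) Ω)) = φ (genericPoint (K := K) Ω) := by
  let root : PreimageTree f (genericPoint (K := K) Ω) := ⟨0, OnePoint.some _, rfl⟩
  have hroot : h.1 root = root := PreimageTree.eq_of_level_eq_zero (h.2 root).1 rfl
  exact OnePoint.coe_injective (congrArg (fun v : PreimageTree f (genericPoint (K := K) Ω) => v.2.1)
    ((H root).trans (congrArg (subtreeEmb φ hφ) hroot)))

theorem exists_genericRep_eq_of_isSection {σ : Gal(Ω/RatFunc K)}
    {h : treeAut f (genericPoint (K := K) Ω)} (H : IsSection hφ (genericRep f Ω σ) h) :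
    ∃ σ' : Gal(Ω/RatFunc K), genericRep f Ω σ' = h ∧ ∀ x, φ (σ' x) = σ (φ x) := by
  let conj : Ω ≃ₐ[K] Ω := (φ.trans (σ.restrictScalars K)).trans φ.symm
  have hconj : ∀ x, φ (conj x) = σ (φ x) := fun x => φ.apply_symm_apply _
  obtain ⟨σ', hσ'⟩ := exists_gal_of_apply_genericPoint conj
    (φ.injective ((hconj _).trans (apply_eq_of_isSection H)))
  have hσ'φ : ∀ x, φ (σ' x) = σ (φ x) := fun x => (congrArg φ (hσ' x)).trans (hconj x)
  refine ⟨σ', Subtype.ext (Equiv.ext fun v => (subtreeEmb φ hφ).injective ?_), hσ'φ⟩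
  have hpoint : ∀ y, OnePoint.map φ (OnePoint.map σ' y) = OnePoint.map σ (OnePoint.map φ y) := by
    rintro (_ | y)
    exacts [rfl, congrArg OnePoint.some (hσ'φ y)]
  have hv : (genericRep f Ω σ).1 (subtreeEmb φ hφ v) = subtreeEmb φ hφ (h.1 v) := H v
  exact hv ▸ PreimageTree.ext rfl (hpoint v.2.1)

theorem map_mem_separableClosure (σ : Gal(Ω/RatFunc K)) {x : Ω} (hx : x ∈ separableClosure K Ω) :
    σ x ∈ separableClosure K Ω :=
  mem_separableClosure_iff.2
    ((σ.restrictScalars K).isSeparable_iff.2 (mem_separableClosure_iff.1 hx))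

theorem genericRep_mem_geometricGroup {σ : Gal(Ω/RatFunc K)}
    (hσ : ∀ x ∈ separableClosure K Ω, σ x = x) : genericRep f Ω σ ∈ geometricGroup f Ω := by
  have hval : σ.toAlgHom.comp (geometricField K Ω).val = (geometricField K Ω).val :=
    IntermediateField.algHom_ext_of_eq_adjoin _ rfl hσ
  exact ⟨IntermediateField.fixingSubgroupEquiv _ ⟨σ, DFunLike.congr_fun hval⟩, rfl⟩

theorem geometricGroup_le_arithmeticGroup : geometricGroup f Ω ≤ arithmeticGroup f Ω := by
  rintro _ ⟨σ, rfl⟩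
  exact ⟨σ.restrictScalars (RatFunc K), rfl⟩

theorem arithmeticGroup_eq_top_of_finiteIndex
    (hφ : ratMap f Ω (OnePoint.some (φ (genericPoint (K := K) Ω))) =
      OnePoint.some (genericPoint (K := K) Ω))
    (hψ : ratMap f Ω (OnePoint.some (ψ (genericPoint (K := K) Ω))) =
      OnePoint.some (genericPoint (K := K) Ω))
    (hne : φ (genericPoint (K := K) Ω) ≠ ψ (genericPoint (K := K) Ω))
    [(arithmeticGroup f Ω).FiniteIndex] : arithmeticGroup f Ω = ⊤ := by
  refine eq_top_of_finiteIndex_of_isSection hφ hψ hne ?_ ?_ <;>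
  · rintro _ ⟨σ, rfl⟩ h H
    obtain ⟨σ', rfl, -⟩ := exists_genericRep_eq_of_isSection H
    exact ⟨σ', rfl⟩

theorem geometricGroup_eq_top_of_arithmeticGroup_eq_top
    (hφ : ratMap f Ω (OnePoint.some (φ (genericPoint (K := K) Ω))) =
      OnePoint.some (genericPoint (K := K) Ω))
    (hψ : ratMap f Ω (OnePoint.some (ψ (genericPoint (K := K) Ω))) =
      OnePoint.some (genericPoint (K := K) Ω))
    (hne : φ (genericPoint (K := K) Ω) ≠ ψ (genericPoint (K := K) Ω))
    (hφK : ∀ x ∈ separableClosure K Ω, φ x = x) (hψK : ∀ x ∈ separableClosure K Ω, ψ x = x)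
    (htop : arithmeticGroup f Ω = ⊤) : geometricGroup f Ω = ⊤ := by
  refine eq_top_iff.2 fun g _ => ?_
  obtain ⟨σ, hσ⟩ : ∃ σ, genericRep f Ω σ = extendSubtree hφ g :=
    (htop ▸ Subgroup.mem_top _ : extendSubtree hφ g ∈ arithmeticGroup f Ω)
  obtain ⟨σ₁, hσ₁, hσ₁φ⟩ := exists_genericRep_eq_of_isSection
    (hσ ▸ isSection_extendSubtree hφ g : IsSection hφ (genericRep f Ω σ) g)
  obtain ⟨σ₂, hσ₂, hσ₂ψ⟩ := exists_genericRep_eq_of_isSection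
    (hσ ▸ isSection_extendSubtree_of_ne hφ hψ hne g : IsSection hψ (genericRep f Ω σ) 1)
  have hg : genericRep f Ω (σ₂⁻¹ * σ₁) = g := by
    rw [map_mul, map_inv, hσ₁, hσ₂, inv_one, one_mul]
  refine hg ▸ genericRep_mem_geometricGroup fun x hx => (AlgEquiv.symm_apply_eq σ₂).2 ?_
  calc σ₁ x = σ x := by
        rw [← hφK _ (map_mem_separableClosure σ₁ hx), hσ₁φ, hφK x hx]
    _ = σ₂ x := by
        rw [← hψK _ (map_mem_separableClosure σ₂ hx), hσ₂ψ, hψK x hx]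

theorem geometricGroup_eq_top_of_finiteIndex [IsSepClosure (RatFunc K) Ω] (hd : 2 ≤ ratDegree f)
    (hW : wronskian f.num f.denom ≠ 0) [(arithmeticGroup f Ω).FiniteIndex] :
    geometricGroup f Ω = ⊤ := by
  have : IsSepClosed Ω := IsSepClosure.sep_closed (RatFunc K)
  have hd' : 1 ≤ ratDegree f := one_le_two.trans hd
  have ht := transcendental_genericPoint (K := K) (Ω := Ω)
  have hcard := isFullTree_of_transcendental hd' hW ht 0 _ rfl
  obtain ⟨y, z, hy, hz, hyz⟩ := (Set.one_lt_ncard_iff (fiber_finite f hd' _)).1 (hcard.symm ▸ hd)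
  obtain ⟨a, rfl, -⟩ := exists_transcendental_of_iterate_eq ht (n := 1) hy
  obtain ⟨b, rfl, -⟩ := exists_transcendental_of_iterate_eq ht (n := 1) hz
  obtain ⟨φ, rfl, hφK⟩ := exists_algEquiv_genericPoint f hy
  obtain ⟨ψ, rfl, hψK⟩ := exists_algEquiv_genericPoint f hz
  have hne : φ (genericPoint (K := K) Ω) ≠ ψ (genericPoint (K := K) Ω) :=
    fun h => hyz (congrArg OnePoint.some h)
  exact geometricGroup_eq_top_of_arithmeticGroup_eq_top hy hz hne hφK hψK
    (arithmeticGroup_eq_top_of_finiteIndex hy hz hne)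

end GaloisGroups

section Reduction

variable {R : Type v} [CommRing R] [IsDomain R] {F : Type w} [Field F] [Algebra R F]
  [IsFractionRing R F]

theorem exists_homogPoint_algebraMap_eq [ValuationRing R] (z : OnePoint F) :
    ∃ x y : R, (x = 1 ∨ y = 1) ∧ homogPoint (algebraMap R F x) (algebraMap R F y) = z := by
  cases z with
  | infty => exact ⟨1, 0, Or.inl rfl, by simp⟩
  | coe z =>
    rcases ValuationRing.isInteger_or_isInteger R z with ⟨r, hr⟩ | ⟨r, hr⟩
    · exact ⟨r, 1, Or.inr rfl, by rw [map_one, homogPoint_one_right, hr]⟩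
    · by_cases hz : z = 0
      · exact ⟨0, 1, Or.inr rfl, by simp [hz]⟩
      · refine ⟨1, r, Or.inl rfl, ?_⟩
        rw [hr, map_one, homogPoint_of_ne_zero _ (inv_ne_zero hz), one_div, inv_inv]

variable {K : Type u} [Field K] [Algebra K R] {E : Type*} [Field E] [Algebra K E] (π : R →ₐ[K] E)

/-- The reduction map `ℙ¹(F) → ℙ¹(E)` of a valuation ring `R` with fraction field `F`, along a
homomorphism `π : R → E` to a field: a point of `ℙ¹(F)` has homogeneous coordinates in `R` one of
which is `1`, and `π` is applied to such coordinates. -/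
noncomputable def reduction [ValuationRing R] (z : OnePoint F) : OnePoint E :=
  homogPoint (π (exists_homogPoint_algebraMap_eq (R := R) z).choose)
    (π (exists_homogPoint_algebraMap_eq (R := R) z).choose_spec.choose)

variable {π}

omit [IsDomain R] in
theorem map_ne_zero_or_of_eq_one {x y : R} (hxy : x = 1 ∨ y = 1) : π x ≠ 0 ∨ π y ≠ 0 :=
  hxy.imp (fun h => by simp [h]) (fun h => by simp [h])

omit [IsDomain R] in
theorem algebraMap_ne_zero_or {x y : R} (hxy : π x ≠ 0 ∨ π y ≠ 0) :
    algebraMap R F x ≠ 0 ∨ algebraMap R F y ≠ 0 := by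
  have h : ∀ {r : R}, π r ≠ 0 → algebraMap R F r ≠ 0 := fun hr h =>
    hr (by rw [(IsFractionRing.injective R F) (h.trans (map_zero _).symm), map_zero])
  exact hxy.imp h h

variable [ValuationRing R]

theorem reduction_homogPoint {x y : R} (hxy : π x ≠ 0 ∨ π y ≠ 0) :
    reduction π (homogPoint (algebraMap R F x) (algebraMap R F y)) = homogPoint (π x) (π y) := by
  have h := exists_homogPoint_algebraMap_eq (R := R)
    (homogPoint (algebraMap R F x) (algebraMap R F y))
  have hprim := map_ne_zero_or_of_eq_one (π := π) h.choose_spec.choose_spec.1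
  have hpoint := h.choose_spec.choose_spec.2
  rw [homogPoint_eq_iff (algebraMap_ne_zero_or hprim) (algebraMap_ne_zero_or hxy), ← map_mul,
    ← map_mul] at hpoint
  refine (homogPoint_eq_iff hprim hxy).2 ?_
  rw [← map_mul, IsFractionRing.injective R F hpoint, map_mul]

theorem reduction_some (r : R) :
    reduction π (OnePoint.some (algebraMap R F r)) = OnePoint.some (π r) := by
  have h := reduction_homogPoint (F := F) (π := π) (x := r) (y := 1) (by simp)
  rwa [map_one, map_one, homogPoint_one_right, homogPoint_one_right] at h

variable [Algebra K F]

theorem reduction_map {T : F ≃ₐ[K] F} {τ : R ≃ₐ[K] R} {s : E ≃ₐ[K] E}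
    (hT : ∀ r, T (algebraMap R F r) = algebraMap R F (τ r)) (hs : ∀ r, π (τ r) = s (π r))
    (z : OnePoint F) : reduction π (OnePoint.map T z) = OnePoint.map s (reduction π z) := by
  obtain ⟨x, y, hxy, rfl⟩ := exists_homogPoint_algebraMap_eq (R := R) z
  have hprim := map_ne_zero_or_of_eq_one (π := π) hxy
  have hT' : OnePoint.map T (homogPoint (algebraMap R F x) (algebraMap R F y)) =
      homogPoint (algebraMap R F (τ x)) (algebraMap R F (τ y)) := by
    rw [← hT, ← hT]
    exact map_homogPoint (T : F →+* F) _ _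
  rw [hT', reduction_homogPoint hprim, reduction_homogPoint (by simpa [hs] using hprim), hs, hs]
  exact (map_homogPoint (s : E →+* E) _ _).symm

variable [IsScalarTower K R F] (f : RatFunc K)

theorem reduction_ratMap (z : OnePoint F) :
    reduction π (ratMap f F z) = ratMap f E (reduction π z) := by
  obtain ⟨x, y, rfl | rfl, rfl⟩ := exists_homogPoint_algebraMap_eq (R := R) z
  · have h := aeval_reflect_num_ne_zero_or f (π y)
    rw [reduction_homogPoint (by simp), map_one, map_one, ratMap_homogPoint_one_left,
      ratMap_homogPoint_one_left]
    simp only [aeval_algebraMap_apply, aeval_algHom_apply] at h ⊢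
    exact reduction_homogPoint h
  · have h := aeval_num_ne_zero_or f (π x)
    rw [reduction_homogPoint (by simp), map_one, map_one, ratMap_homogPoint_one_right,
      ratMap_homogPoint_one_right]
    simp only [aeval_algebraMap_apply, aeval_algHom_apply] at h ⊢
    exact reduction_homogPoint h

theorem exists_reduction_eq [IsAdicComplete (RingHom.ker π) R] (hπ : Function.Surjective π)
    {v : OnePoint F} {c : OnePoint E} (hc : ratMap f E c = reduction π v)
    (hcrit : ¬ IsCriticalPoint f E c) : ∃ z, ratMap f F z = v ∧ reduction π z = c := by
  obtain ⟨a, b, hab, rfl⟩ := exists_homogPoint_algebraMap_eq (R := R) v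
  have hab' := map_ne_zero_or_of_eq_one (π := π) hab
  have hab'' := algebraMap_ne_zero_or (F := F) hab'
  rw [reduction_homogPoint hab'] at hc
  cases c with
  | infty =>
    rw [← homogPoint_zero_right 1, ratMap_homogPoint_one_left_eq_iff f 0 hab'] at hc
    obtain ⟨r, hr, hrc⟩ := exists_lift_root_pencil π hπ hab' (c := 0)
      (by rw [eval_pencil, sub_eq_zero]; exact hc) hcrit
    rw [eval_pencil, sub_eq_zero] at hr
    refine ⟨homogPoint 1 (algebraMap R F r), ?_, ?_⟩
    · rw [ratMap_homogPoint_one_left_eq_iff f _ hab'', aeval_algebraMap_apply,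
        aeval_algebraMap_apply, ← map_mul, ← map_mul, hr]
    · rw [← map_one (algebraMap R F), reduction_homogPoint (by simp), hrc, homogPoint_zero_right]
  | coe c =>
    rw [← homogPoint_one_right, ratMap_homogPoint_one_right_eq_iff f c hab'] at hc
    obtain ⟨r, hr, hrc⟩ := exists_lift_root_pencil π hπ hab' (c := c)
      (by rw [eval_pencil, sub_eq_zero]; exact hc) hcrit
    rw [eval_pencil, sub_eq_zero] at hr
    refine ⟨OnePoint.some (algebraMap R F r), ?_, ?_⟩
    · rw [← homogPoint_one_right, ratMap_homogPoint_one_right_eq_iff f _ hab'',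
        aeval_algebraMap_apply, aeval_algebraMap_apply, ← map_mul, ← map_mul, hr]
    · rw [reduction_some, hrc]

end Reduction

section Specialization

variable {K : Type u} [Field K] {f : RatFunc K}

theorem exists_algEquiv_algebraicClosure {F : Type*} [Field F] {L : Type*} [Field L] [Algebra F L]
    (τ : Gal(L/F)) : ∃ S : Gal(AlgebraicClosure L/F), ∀ x,
      S (algebraMap L (AlgebraicClosure L) x) = algebraMap L (AlgebraicClosure L) (τ x) := by
  let S := IsAlgClosure.equivOfEquiv (AlgebraicClosure L) (AlgebraicClosure L) τ.toRingEquiv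
  have hS : ∀ x, S (algebraMap L (AlgebraicClosure L) x) =
      algebraMap L (AlgebraicClosure L) (τ x) :=
    IsAlgClosure.equivOfEquiv_algebraMap _ _ τ.toRingEquiv
  refine ⟨AlgEquiv.ofRingEquiv (f := S) fun r => ?_, hS⟩
  rw [IsScalarTower.algebraMap_apply F L (AlgebraicClosure L), hS, τ.commutes]

theorem exists_algEquiv_of_normal {F : Type*} [Field F] {M : Type*} [Field M] [Algebra F M]
    [Normal F M] {A : Type*} [Field A] [Algebra F A] (j : M →ₐ[F] A) (S : Gal(A/F)) :
    ∃ σ : Gal(M/F), ∀ x, j (σ x) = S (j x) := by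
  let := j.toAlgebra
  have : IsScalarTower F M A := IsScalarTower.of_algebraMap_eq fun x => (j.commutes x).symm
  exact ⟨S.restrictNormal M, S.restrictNormal_commutes M⟩

theorem exists_treeAut_mulEquiv_arborealRep {F : Type*} [Field F] [Algebra K F]
    {L : Type v} [Field L] [Algebra K L] [Algebra F L] [IsScalarTower K F L]
    {Ω : Type w} [Field Ω] [Algebra K Ω] [Algebra F Ω] [IsScalarTower K F Ω] [IsSepClosure F Ω]
    (hd : 1 ≤ ratDegree f) {x : F} (hL : IsFullTree f (algebraMap F L x))
    (hΩ : IsFullTree f (algebraMap F Ω x)) :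
    ∃ Φ : treeAut f (algebraMap F L x) ≃* treeAut f (algebraMap F Ω x), ∀ τ : Gal(L/F),
      ∃ σ : Gal(Ω/F), Φ (arborealRep f F (Set.mem_range_self x) τ) =
        arborealRep f F (Set.mem_range_self x) σ := by
  let A := AlgebraicClosure L
  have : IsScalarTower K F A := .to₁₂₄ K F L A
  let j : Ω →ₐ[F] A := IsSepClosed.lift
  let ι : L →ₐ[F] A := IsScalarTower.toAlgHom F L A
  have hcj : Function.Semiconj (OnePoint.map j) (ratMap f Ω) (ratMap f A) := fun z =>
    (ratMap_map_algHom f (j.restrictScalars K) z).symm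
  have hcι : Function.Semiconj (OnePoint.map ι) (ratMap f L) (ratMap f A) := fun z =>
    (ratMap_map_algHom f (ι.restrictScalars K) z).symm
  have hbj := hΩ.bijOn_of_injective hd hcj (Option.map_injective j.injective)
    (congrArg OnePoint.some (j.commutes x))
  have hbι := hL.bijOn_of_injective hd hcι (Option.map_injective ι.injective)
    (congrArg OnePoint.some (ι.commutes x))
  refine ⟨(treeAutCongr _ hbι hcι).trans (treeAutCongr _ hbj hcj).symm, fun τ => ?_⟩
  obtain ⟨S, hS⟩ := exists_algEquiv_algebraicClosure τ
  obtain ⟨σ, hσ⟩ := exists_algEquiv_of_normal j S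
  have hιS : ∀ y, OnePoint.map ι (OnePoint.map τ y) = OnePoint.map S (OnePoint.map ι y) :=
    Option.forall.2 ⟨rfl, fun y => congrArg OnePoint.some (hS y).symm⟩
  have hjS : ∀ y, OnePoint.map j (OnePoint.map σ y) = OnePoint.map S (OnePoint.map j y) :=
    Option.forall.2 ⟨rfl, fun y => congrArg OnePoint.some (hσ y)⟩
  refine ⟨σ, (treeAutCongr _ hbj hcj).symm_apply_eq.2 ?_⟩
  exact (treeAutCongr_arborealRep _ hbι hcι _ (Set.mem_range_self x) hιS).trans
    (treeAutCongr_arborealRep _ hbj hcj _ (Set.mem_range_self x) hjS).symm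

variable {E : Type v} [Field E] [Algebra K E]

theorem exists_algebra_ratFunc {t : E} (ht : Transcendental K t) :
    ∃ (_ : Algebra (RatFunc K) E) (_ : IsScalarTower K (RatFunc K) E),
      genericPoint (K := K) E = t := by
  let i : RatFunc K →ₐ[K] E := (IntermediateField.val _).comp
    (RatFunc.algEquivOfTranscendental t ht).toAlgHom
  let inst : Algebra (RatFunc K) E := i.toRingHom.toAlgebra
  refine ⟨inst, IsScalarTower.of_algebraMap_eq fun x => (i.commutes x).symm, ?_⟩
  exact (RatFunc.algEquivOfTranscendental_X t ht :)

section Reduction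

variable {R : Type w} [CommRing R] [IsDomain R] [ValuationRing R] [Algebra K R] {F : Type*}
  [Field F] [Algebra R F] [IsFractionRing R F] [Algebra K F] [IsScalarTower K R F]
  {π : R →ₐ[K] E} [IsAdicComplete (RingHom.ker π) R] {x : R} {t : F} {y : E}
  (hd : 1 ≤ ratDegree f) (hπ : Function.Surjective π) (ht : algebraMap R F x = t) (hy : π x = y)
  (hfull : IsFullTree f y)
  (hcrit : ∀ n c, (ratMap f E)^[n + 1] c = OnePoint.some y → ¬IsCriticalPoint f E c)

include hd hπ ht hy hfull hcrit

theorem bijOn_fiber_reduction (n : ℕ) (v : OnePoint F)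
    (hv : (ratMap f F)^[n] v = OnePoint.some t) :
    Set.BijOn (reduction π) {z | ratMap f F z = v} {z | ratMap f E z = reduction π v} := by
  subst ht hy
  have hc : Function.Semiconj (reduction π) (ratMap f F) (ratMap f E) := reduction_ratMap f
  refine hfull.bijOn_fiber_of_surjOn hd hc (reduction_some x) hv fun c hcv => ?_
  refine exists_reduction_eq f hπ hcv (hcrit n c ?_)
  rw [Function.iterate_succ_apply, show ratMap f E c = reduction π v from hcv,
    ← (hc.iterate_right n).eq, hv, reduction_some]

theorem isFullTree_of_reduction : IsFullTree f t :=
  hfull.of_bijOn (reduction_ratMap f) (ht ▸ hy ▸ reduction_some x)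
    (bijOn_fiber_reduction hd hπ ht hy hfull hcrit)

theorem bijOn_level_reduction (n : ℕ) :
    Set.BijOn (reduction π) {z | (ratMap f F)^[n] z = OnePoint.some t}
      {z | (ratMap f E)^[n] z = OnePoint.some y} := by
  have hroot : reduction π (OnePoint.some t) = OnePoint.some y := ht ▸ hy ▸ reduction_some x
  exact hroot ▸ bijOn_iterate_fiber (reduction_ratMap f)
    (bijOn_fiber_reduction hd hπ ht hy hfull hcrit) n

end Reduction

variable (K E) in
/-- The residue map `E⟦X⟧ → E` of the ring of power series, as a homomorphism of `K`-algebras. -/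
noncomputable def residueHom : PowerSeries E →ₐ[K] E :=
  { PowerSeries.constantCoeff with commutes' := fun x => by simp [PowerSeries.algebraMap_apply] }

theorem ker_residueHom : RingHom.ker (residueHom K E) = Ideal.span {PowerSeries.X} := by
  ext r
  rw [Ideal.mem_span_singleton, PowerSeries.X_dvd_iff]
  rfl

instance isAdicComplete_ker_residueHom :
    IsAdicComplete (RingHom.ker (residueHom K E)) (PowerSeries E) :=
  ker_residueHom (K := K) (E := E) ▸ inferInstance

theorem residueHom_surjective : Function.Surjective (residueHom K E) :=
  fun c => ⟨PowerSeries.C c, PowerSeries.constantCoeff_C c⟩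

/-- The action of an automorphism of `E` on the coefficients of power series. -/
noncomputable def coeffAut (s : E ≃ₐ[K] E) : PowerSeries E ≃ₐ[K] PowerSeries E :=
  AlgEquiv.ofAlgHom (PowerSeries.mapAlgHom (s : E →ₐ[K] E))
    (PowerSeries.mapAlgHom (s.symm : E →ₐ[K] E))
    (AlgHom.ext fun r => PowerSeries.ext fun n => by simp [PowerSeries.mapAlgHom_apply])
    (AlgHom.ext fun r => PowerSeries.ext fun n => by simp [PowerSeries.mapAlgHom_apply])

theorem residueHom_coeffAut (s : E ≃ₐ[K] E) (r : PowerSeries E) :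
    residueHom K E (coeffAut s r) = s (residueHom K E r) :=
  (PowerSeries.coeff_zero_eq_constantCoeff_apply _).symm.trans <|
    (PowerSeries.coeff_map (s : E →+* E) 0 r).trans <|
      congrArg s (PowerSeries.coeff_zero_eq_constantCoeff_apply r)

variable (E) in
/-- The power series `α + X`, the value of `t` in the specialization of `t` to `α`. -/
noncomputable def shiftedX (α : K) : PowerSeries E :=
  Polynomial.coeToPowerSeries.algHom E (X + C α)

theorem residueHom_shiftedX (α : K) : residueHom K E (shiftedX E α) = algebraMap K E α := by
  change PowerSeries.constantCoeff (shiftedX E α) = _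
  simp [shiftedX]

theorem coeffAut_shiftedX (s : E ≃ₐ[K] E) (α : K) : coeffAut s (shiftedX E α) = shiftedX E α := by
  change (shiftedX E α).map (s : E →+* E) = _
  simp [shiftedX]

theorem transcendental_shiftedX (α : K) : Transcendental K (shiftedX E α) := by
  have h : Transcendental K (X + C α : K[X]) :=
    Polynomial.transcendental _ (by simp) (by simp)
  exact fun h' => h ((isAlgebraic_algHom_iff _ ((PowerSeries.map_injective _
    (algebraMap K E).injective).comp (Polynomial.coe_injective K))).1 h')

theorem exists_treeAut_mulEquiv_specialization [IsSepClosed E] [Algebra.IsAlgebraic K E]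
    {L : Type w} [Field L] [Algebra (PowerSeries E) L] [IsFractionRing (PowerSeries E) L]
    [Algebra K L] [IsScalarTower K (PowerSeries E) L] [Algebra (RatFunc K) L]
    [IsScalarTower K (RatFunc K) L] (hd : 1 ≤ ratDegree f) {α : K}
    (hα : ¬IsStrictlyPostcritical f α)
    (ht : algebraMap (PowerSeries E) L (shiftedX E α) = genericPoint (K := K) L) :
    IsFullTree f (genericPoint (K := K) L) ∧
      ∃ Φ : treeAut f (genericPoint (K := K) L) ≃* treeAut f (algebraMap K E α),
        ∀ s : Gal(E/K), ∃ τ : Gal(L/RatFunc K),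
          Φ (genericRep f L τ) = arborealRep f K (Set.mem_range_self α) s := by
  have hfull := isFullTree_of_not_isStrictlyPostcritical hd hα E
  have hcrit := fun n c => not_isCriticalPoint_of_not_isStrictlyPostcritical hα (M := E) (n := n)
    (c := c)
  have hy := residueHom_shiftedX (E := E) α
  have hbij := bijOn_level_reduction hd residueHom_surjective ht hy hfull hcrit
  refine ⟨isFullTree_of_reduction hd residueHom_surjective ht hy hfull hcrit,
    treeAutCongr _ hbij (reduction_ratMap f), fun s => ?_⟩
  let T : L ≃ₐ[K] L := IsFractionRing.algEquivOfAlgEquiv (coeffAut s)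
  have hT : ∀ r, T (algebraMap _ L r) = algebraMap _ L (coeffAut s r) :=
    IsFractionRing.algEquivOfAlgEquiv_algebraMap (coeffAut s)
  obtain ⟨τ, hτ⟩ := exists_gal_of_apply_genericPoint T (by rw [← ht, hT, coeffAut_shiftedX])
  refine ⟨τ, treeAutCongr_arborealRep _ hbij (reduction_ratMap f) _ _ fun y => ?_⟩
  rw [show ⇑τ = ⇑T from funext hτ]
  exact reduction_map hT (residueHom_coeffAut s) y

theorem finiteIndex_arithmeticGroup {Ksep : Type v} [Field Ksep] [Algebra K Ksep]
    [IsSepClosure K Ksep] {Ω : Type w} [Field Ω] [Algebra (RatFunc K) Ω]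
    [IsSepClosure (RatFunc K) Ω] [Algebra K Ω] [IsScalarTower K (RatFunc K) Ω]
    (hd : 2 ≤ ratDegree f) {α : K} (hα : ¬IsStrictlyPostcritical f α)
    (hfin : (specializationGroup f Ksep α).FiniteIndex) :
    (arithmeticGroup f Ω).FiniteIndex := by
  have : IsSepClosed Ω := IsSepClosure.sep_closed (RatFunc K)
  have : IsSepClosed Ksep := IsSepClosure.sep_closed K
  have : Algebra.IsAlgebraic K Ksep := Algebra.IsSeparable.isAlgebraic _ _
  have hd₁ : 1 ≤ ratDegree f := one_le_two.trans hd
  obtain ⟨_, _, ht⟩ := exists_algebra_ratFunc ((transcendental_algebraMap_iff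
    (IsFractionRing.injective (PowerSeries Ksep) (FractionRing (PowerSeries Ksep)))).2
      (transcendental_shiftedX (K := K) α))
  obtain ⟨hfull, Φ, hΦ⟩ := exists_treeAut_mulEquiv_specialization hd₁ hα ht.symm
  obtain ⟨Ψ, hΨ⟩ := exists_treeAut_mulEquiv_arborealRep hd₁ hfull (isFullTree_of_transcendental hd₁
    (wronskian_ne_zero_of_not_isStrictlyPostcritical hd hα)
    (transcendental_genericPoint (K := K) (Ω := Ω)))
  let e : treeAut f (algebraMap K Ksep α) ≃* treeAut f (genericPoint (K := K) Ω) :=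
    Φ.symm.trans Ψ
  have hle : (specializationGroup f Ksep α).map e.toMonoidHom ≤ arithmeticGroup f Ω := by
    rintro _ ⟨_, ⟨s, rfl⟩, rfl⟩
    obtain ⟨τ, hτ⟩ := hΦ s
    obtain ⟨σ, hσ⟩ := hΨ τ
    exact ⟨σ, hσ.symm.trans (congrArg Ψ (Φ.symm_apply_eq.2 hτ.symm).symm)⟩
  have hmap : ((specializationGroup f Ksep α).map e.toMonoidHom).FiniteIndex :=
    ⟨(Subgroup.index_map_equiv _ e).trans_ne hfin.index_ne_zero⟩
  exact Subgroup.finiteIndex_of_le hle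

end Specialization

end Arboreal

theorem corollary1 {K : Type*} [Field K]
    {Ksep : Type*} [Field Ksep] [Algebra K Ksep] [IsSepClosure K Ksep]
    {Ω : Type*} [Field Ω] [Algebra (RatFunc K) Ω] [IsSepClosure (RatFunc K) Ω]
    [Algebra K Ω] [IsScalarTower K (RatFunc K) Ω]
    (f : RatFunc K) (hd : 2 ≤ Arboreal.ratDegree f)
    (α : K) (hα : ¬ Arboreal.IsStrictlyPostcritical f α)
    (hfin : (Arboreal.specializationGroup f Ksep α).FiniteIndex) :
    Arboreal.geometricGroup f Ω = Arboreal.arithmeticGroup f Ω ∧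
      Arboreal.arithmeticGroup f Ω = ⊤ := by
  have := Arboreal.finiteIndex_arithmeticGroup (Ω := Ω) hd hα hfin
  have hgeom : Arboreal.geometricGroup f Ω = ⊤ :=
    Arboreal.geometricGroup_eq_top_of_finiteIndex hd
      (Arboreal.wronskian_ne_zero_of_not_isStrictlyPostcritical hd hα)
  have harith : Arboreal.arithmeticGroup f Ω = ⊤ :=
    top_le_iff.1 (hgeom ▸ Arboreal.geometricGroup_le_arithmeticGroup)
  exact ⟨hgeom.trans harith.symm, harith⟩
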